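/- In a tree of order $n$, a \emph{strong almost-perfect matching} is a matching that covers all vertices but one if $n$ is odd, and all vertices but two if $n$ is even, such that every uncovered vertex is a leaf (a vertex of degree $1$). Let $f(n)$ be the maximum number of strong almost-perfect matchings in a tree of order $n$. The \emph{spider with $k$ legs} is the tree of order $2k+1$ obtained from a star with $k$ edges by subdividing every edge once. The star of order $4$ is $S_4$, the path of order $2$ is $P_2$, and $DB_{2,2}$ is the tree of order $6$ consisting of two adjacent vertices with two leaves attached to each of them. For even $n\ge 4$, the \emph{even special spider} $SSS_n$ is obtained from the spider with $\frac{n-2}{2}$ legs by adding one new leaf adjacent to the neighbour of one of its leaves. For $a,b,c\ge 0$, the \emph{spider-trio} $ST_{a,b,c}$, of order $2(a+b+c)+4$, consists of three disjoint spiders with $a$, $b$ and $c$ legs (a spider with $0$ legs being a single vertex, its centre) and one new vertex adjacent to the three centres. It is \emph{balanced} if, for $a\ge b\ge c$, one has $c\ge a-1$. (1) For even $n\ge 2$, $$f(n)=\begin{cases}\lfloor 3n/4\rfloor & \text{if } 2\le n\le 6,\\ n-3 & \text{if } 8\le n\le 14,\\ \lfloor n^2/16\rfloor-1 & \text{if }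 16\le n\le 28,\\ \lfloor (n-4)^2/12\rfloor & \text{if } n\ge 28.\end{cases}$$ (2) For even $n\ge 2$, a tree $T$ of order $n$ has exactly $f(n)$ strong almost-perfect matchings if and only if $T$ is isomorphic to one of the following trees: $P_2$, $S_4$, $DB_{2,2}$ for $n=2,4,6$ respectively; $SSS_n$ if $8\le n\le 12$; $SSS_{14}$ or $ST_{3,2,0}$ if $n=14$; $ST_{\lceil (n-4)/4\rceil,\lfloor (n-4)/4\rfloor,0}$ if $16\le n\le 26$; $ST_{6,6,0}$ or $ST_{4,4,4}$ if $n=28$; $ST_{\lfloor n/6\rfloor,\lfloor (n-2)/6\rfloor,\lfloor (n-4)/6\rfloor}$ if $n>28$. (3) Consequently, let $T$ be a tree of order $n\ge 28$. If $n$ is odd, then $T$ has at most $\frac{n-1}{2}$ strong almost-perfect matchings, with equality if and only if $T$ is the spider with $\frac{n-1}{2}$ legs. If $n$ is even, then $T$ has at most $\lfloor (n-4)^2/12\rfloor$ strong almost-perfect matchings, with equality if and only if $T$ is a balanced spider-trio, or $n=28$ and $T$ is $ST_{6,6,0}$. -/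

import Mathlib

universe u

namespace SimpleGraph

variable {V : Type u}

/-- A leaf: a vertex with exactly one neighbour. -/
def IsLeafVertex (G : SimpleGraph V) (v : V) : Prop :=
  (G.neighborSet v).ncard = 1

/-- A strong almost-perfect matching: a matching (given as a subgraph all of whose vertices are
matched) that covers all vertices but one if the order is odd, all vertices but two if the order is
even, and such that every avoided (uncovered) vertex is a leaf of the graph. -/
def IsStrongAlmostPerfectMatching (G : SimpleGraph V) (M : G.Subgraph) : Prop :=
  M.IsMatching ∧
    (M.vertsᶜ).ncard = (if Even (Nat.card V) then 2 else 1) ∧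
    ∀ v ∉ M.verts, G.IsLeafVertex v

/-- The number of strong almost-perfect matchings of a (finite) graph. -/
noncomputable def numSAPM (G : SimpleGraph V) : ℕ :=
  {M : G.Subgraph | G.IsStrongAlmostPerfectMatching M}.ncard

/-- `k` is the maximum number of strong almost-perfect matchings in a tree of order `n`. -/
def IsMaxNumSAPM (n k : ℕ) : Prop :=
  IsGreatest {m : ℕ | ∃ T : SimpleGraph (Fin n), T.IsTree ∧ T.numSAPM = m} k

/-- Add to `G` one new vertex `none`, adjacent to exactly the vertices in `S`. -/
def addVertex (G : SimpleGraph V) (S : Set V) : SimpleGraph (Option V) where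
  Adj
    | none, none => False
    | none, some v => v ∈ S
    | some v, none => v ∈ S
    | some v, some w => G.Adj v w
  symm := ⟨by
    rintro (_ | v) (_ | w) h
    · exact h
    · exact h
    · exact h
    · exact G.adj_symm h⟩
  loopless := ⟨by
    rintro (_ | v) h
    · exact h
    · exact G.loopless.irrefl v h⟩

/-- The double broom with `a` leaves at one centre (`Sum.inl none`) and `b` leaves at the other
centre (`Sum.inr none`), the two centres being adjacent. -/
def doubleBroom (a b : ℕ) : SimpleGraph (Option (Fin a) ⊕ Option (Fin b)) :=
  (starGraph none ⊕g starGraph none) ⊔ edge (Sum.inl none) (Sum.inr none)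

/-- The spider with `k` legs of length two, i.e. the star with `k` edges, each subdivided once; it
has order `2 * k + 1`. The centre is `none`, and leg `i` runs from the centre through
`some (i, false)` to the leaf `some (i, true)`. -/
def spider (k : ℕ) : SimpleGraph (Option (Fin k × Bool)) :=
  fromRel fun
    | none, some (_, false) => True
    | some (i, false), some (j, true) => i = j
    | _, _ => False

/-- The even special spider of (even) order `n`: the spider of order `n - 1`, with a sibling added
for one of its leaves (the leaf of leg number `0`). -/
def evenSpecialSpider (n : ℕ) : SimpleGraph (Option (Option (Fin ((n - 2) / 2) × Bool))) :=
  (spider ((n - 2) / 2)).addVertex {v | ∃ i, i.val = 0 ∧ v = some (i, false)}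

/-- The spider-trio: three disjoint spiders with `a`, `b`, `c` legs of length two, and one new
vertex adjacent to their three centres; it has order `2 * (a + b + c) + 4`. -/
def spiderTrio (a b c : ℕ) : SimpleGraph
    (Option (Option (Fin a × Bool) ⊕ (Option (Fin b × Bool) ⊕ Option (Fin c × Bool)))) :=
  (spider a ⊕g (spider b ⊕g spider c)).addVertex
    {.inl none, .inr (.inl none), .inr (.inr none)}

/-- `G` is (isomorphic to) a balanced spider-trio. -/
def IsBalancedSpiderTrio (G : SimpleGraph V) : Prop :=
  ∃ a b c : ℕ, b ≤ a ∧ c ≤ b ∧ a ≤ c + 1 ∧ Nonempty (G ≃g spiderTrio a b c)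

end SimpleGraph

/-! A tree has at most one perfect matching off a given vertex set (`CoversOff.unique`), so a strong
almost-perfect matching is determined by the set of leaves it avoids. Everything becomes a count of
avoidable sets: one leaf for odd order, two for even order.

The main tools are the edge bound for forests (`IsAcyclic.mul_card_lt`) and tight sets: minimal sets
`D` with `#D = #(G.nbrs D) + k`. By Hall's condition an avoided set must meet every set with more
vertices than neighbours, and by minimality each neighbour of a tight set has at least two
neighbours in it.

Let the order be `2 * s + 4`, with an avoidable pair `S`. The sizes of the two colour classes differ
by 0 or 2.

If they differ by 2, the larger class contains a tight set `D` of excess two. The forest bound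
leaves two possibilities (`IsTight.degree_cases`). Either all neighbours of `D` have degree two into
`D`, and then `D` yields two separated tight sets of excess one, each containing one avoided leaf;
or exactly one neighbour, the hub, has degree three. The hub splits `D` into three branches, of
which `S` meets two, and `IsHub.exists_bound` bounds the count by that of a spider-trio, with
equality at full order only for the spider-trio itself.

If the classes have equal size and there is no perfect matching, Hall violators in both classes
again give two separated tight sets. If there is a perfect matching, leaves are matched to
non-leaves, so there are at most `s + 2` leaves. With at most `s + 1` leaves the count is a product
`x * y` with `x + y ≤ s + 1`; with `s + 2` leaves, avoidable pairs inject into the edges of the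
forest on the `s + 2` non-leaves.

`IsTree.pairBound` collects these alternatives. Elementary optimisation (`trioCount_le_evenMax` and
the strict inequalities after it) shows that only spider-trios attain the maximum, apart from the
double broom at order 6. The star and the even special spider are the spider-trios with parameters
`0, 0, 0` and `s, 0, 0`.

For odd order, all avoidable leaves lie in the larger colour class, which also contains a non-leaf.
Equality makes that class a centre together with leaves having distinct neighbours, which is a
spider. -/

namespace SimpleGraph
section
open scoped Classical
open Finset

variable {V : Type*} [Fintype V] {G : SimpleGraph V}

/-! ### Edge counts in forests and colour classes -/

/-- In a forest, the number of edges between two disjoint vertex sets, not both empty, is less than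
the total number of vertices of these sets. -/
lemma IsAcyclic.card_filter_adj_lt (hG : G.IsAcyclic) {X Y : Finset V} (hXY : Disjoint X Y)
    (hne : (X ∪ Y).Nonempty) {P : Finset (V × V)}
    (hP : ∀ p ∈ P, p.1 ∈ Y ∧ p.2 ∈ X ∧ G.Adj p.1 p.2) : #P + 1 ≤ #X + #Y := by
  rw [← card_union_of_disjoint hXY]
  set W := X ∪ Y with hW
  have hac : (G.induce (W : Set V)).IsAcyclic := hG.induce _
  have : Nonempty (W : Set V) := by
    obtain ⟨w, hw⟩ := hne
    exact ⟨⟨w, hw⟩⟩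
  -- The induced forest is enlarged to a spanning tree of the complete graph on `W`, which has
  -- exactly `#W - 1` edges.
  obtain ⟨T, hT, -, htree⟩ :=
    (SimpleGraph.connected_top (V := (W : Set V))).exists_isTree_le_of_le_of_isAcyclic le_top hac
  have hcard := htree.card_edgeFinset
  have h1 : #P ≤ #T.edgeFinset := by
    have hsub : P.image (fun p => s(p.1, p.2)) ⊆ T.edgeFinset.image (Sym2.map Subtype.val) := by
      intro e he
      obtain ⟨p, hp, rfl⟩ := mem_image.1 he
      obtain ⟨hy, hx, ha⟩ := hP p hp
      refine mem_image.2 ⟨s(⟨p.1, by simp [hW, hy]⟩, ⟨p.2, by simp [hW, hx]⟩), ?_, by simp⟩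
      rw [mem_edgeFinset, mem_edgeSet]
      exact hT (by simpa using ha)
    have hinj : #(P.image (fun p => s(p.1, p.2))) = #P := by
      apply card_image_of_injOn
      rintro ⟨a, b⟩ hp ⟨c, d⟩ hq h
      have hp' := hP _ hp
      have hq' := hP _ hq
      simp only [Sym2.eq_iff] at h
      rcases h with ⟨rfl, rfl⟩ | ⟨rfl, rfl⟩
      · rfl
      · exact absurd hp'.1 (Finset.disjoint_left.1 hXY hq'.2.1)
    rw [← hinj]
    exact (card_le_card hsub).trans card_image_le
  have h2 : Fintype.card (W : Set V) = #W := by simp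
  omega

lemma IsAcyclic.sum_card_filter_adj_lt (hG : G.IsAcyclic) {X Y : Finset V} (hXY : Disjoint X Y)
    (hne : (X ∪ Y).Nonempty) : ∑ b ∈ Y, #{x ∈ X | G.Adj b x} + 1 ≤ #X + #Y := by
  have h := hG.card_filter_adj_lt hXY hne (P := (Y ×ˢ X).filter fun p => G.Adj p.1 p.2)
    (by simp; tauto)
  have h2 : #((Y ×ˢ X).filter fun p => G.Adj p.1 p.2) = ∑ b ∈ Y, #{x ∈ X | G.Adj b x} := by
    simp_rw [card_filter, sum_product]
  omega

/-- Mostly used with `k = 2`: if every vertex of `Y` has two neighbours in `X`, then `#Y < #X`. -/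
lemma IsAcyclic.mul_card_lt (hG : G.IsAcyclic) {X Y : Finset V} (hXY : Disjoint X Y)
    (hne : (X ∪ Y).Nonempty) {k : ℕ} (h : ∀ b ∈ Y, k ≤ #{x ∈ X | G.Adj b x}) :
    k * #Y + 1 ≤ #X + #Y := by
  have h1 := hG.sum_card_filter_adj_lt hXY hne
  have h2 := card_nsmul_le_sum Y (fun b => #{x ∈ X | G.Adj b x}) k h
  rw [smul_eq_mul, mul_comm] at h2
  omega

/-- In a connected graph, a nonempty set of vertices closed under adjacency is everything. -/
lemma Connected.eq_univ_of_closed (hG : G.Connected) {C : Finset V} (hne : C.Nonempty)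
    (h : ∀ x ∈ C, ∀ y, G.Adj x y → y ∈ C) : C = univ := by
  obtain ⟨x, hx⟩ := hne
  refine eq_univ_iff_forall.2 fun y => ?_
  obtain ⟨w⟩ := hG.preconnected x y
  induction w with
  | nil => exact hx
  | cons hadj _ ih => exact ih (h _ hx _ hadj)

/-- A colour class of a proper two-colouring. -/
def IsColourClass (G : SimpleGraph V) (A : Finset V) : Prop :=
  ∀ ⦃x y⦄, G.Adj x y → (x ∈ A ↔ y ∉ A)

lemma IsColourClass.compl {A : Finset V} (h : G.IsColourClass A) : G.IsColourClass Aᶜ := by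
  intro x y hxy
  have := h hxy
  simp only [mem_compl]
  tauto

lemma IsTree.exists_isColourClass (hG : G.IsTree) : ∃ A : Finset V, G.IsColourClass A := by
  obtain ⟨c⟩ := hG.colorable_two
  refine ⟨univ.filter fun v => c v = 0, fun x y hxy => ?_⟩
  have := c.valid hxy
  simp only [mem_filter, mem_univ, true_and]
  generalize c x = a at *
  generalize c y = b at *
  fin_cases a <;> fin_cases b <;> simp_all

lemma IsLeafVertex.exists_adj_iff {v : V} (h : G.IsLeafVertex v) :
    ∃ w, ∀ x, G.Adj v x ↔ x = w := by
  obtain ⟨w, hw⟩ := Set.ncard_eq_one.1 h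
  refine ⟨w, fun x => ?_⟩
  rw [← mem_neighborSet, hw, Set.mem_singleton_iff]

lemma IsLeafVertex.eq_of_adj {v x y : V} (h : G.IsLeafVertex v) (hx : G.Adj v x)
    (hy : G.Adj v y) : x = y := by
  obtain ⟨w, hw⟩ := h.exists_adj_iff
  rw [(hw x).1 hx, (hw y).1 hy]

lemma isLeafVertex_of_forall {v w : V} (h : ∀ x, G.Adj v x ↔ x = w) : G.IsLeafVertex v := by
  refine Set.ncard_eq_one.2 ⟨w, ?_⟩
  ext x
  simpa using h x

/-! ### Matchings and the leaf sets they avoid -/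

/-- The function `m` is a perfect matching of the graph with the vertices in `S` removed. -/
def CoversOff (G : SimpleGraph V) (S : Finset V) (m : V → V) : Prop :=
  ∀ v ∉ S, m v ∉ S ∧ G.Adj v (m v) ∧ m (m v) = v

lemma CoversOff.injOn {S : Finset V} {m : V → V} (h : G.CoversOff S m) {x y : V} (hx : x ∉ S)
    (hy : y ∉ S) (hxy : m x = m y) : x = y := by
  rw [← (h x hx).2.2, ← (h y hy).2.2, hxy]

/-- A tree has at most one perfect matching. -/
lemma CoversOff.unique (hG : G.IsTree) {S : Finset V} {m m' : V → V}
    (h : G.CoversOff S m) (h' : G.CoversOff S m') {v : V} (hv : v ∉ S) : m v = m' v := by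
  obtain ⟨A, hA⟩ := hG.exists_isColourClass
  by_contra hne
  -- Both matchings preserve the set `W` where they disagree. Each vertex of `W ∩ A` thus has two
  -- neighbours in `W \ A`, so the forest bound makes `W \ A` strictly larger, whereas `m` injects
  -- it into `W ∩ A`.
  set W := univ.filter fun v => v ∉ S ∧ m v ≠ m' v with hW
  have hWm : ∀ x ∈ W, m x ∈ W ∧ m' x ∈ W := by
    intro x hx
    simp only [hW, mem_filter, mem_univ, true_and] at hx ⊢
    have h1 := h x hx.1
    have h2 := h' x hx.1
    refine ⟨⟨h1.1, fun e => hx.2 ?_⟩, ⟨h2.1, fun e => hx.2 ?_⟩⟩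
    · rw [h1.2.2] at e
      have h3 := (h' _ h1.1).2.2
      rw [← e] at h3
      exact h3.symm
    · rw [h2.2.2] at e
      have h3 := (h _ h2.1).2.2
      rw [e] at h3
      exact h3
  have hWS : ∀ x ∈ W, x ∉ S := fun x hx => (mem_filter.1 hx).2.1
  have hvW : v ∈ W := by simp [hW, hv, hne]
  have hdisj : Disjoint (W \ A) (W ∩ A) := by
    rw [Finset.disjoint_left]; intro x; simp; tauto
  have hcard := hG.isAcyclic.mul_card_lt (k := 2) hdisj (by
    refine ⟨v, ?_⟩
    by_cases hvA : v ∈ A <;> simp [hvA, hvW]) (by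
    intro b hb
    rw [mem_inter] at hb
    have hsub : ({m b, m' b} : Finset V) ⊆ {x ∈ W \ A | G.Adj b x} := by
      intro x hx
      have h1 := (h b (hWS b hb.1)).2.1
      have h2 := (h' b (hWS b hb.1)).2.1
      have h3 := hA h1
      have h4 := hA h2
      have h5 := hWm b hb.1
      simp only [mem_insert, mem_singleton] at hx
      rcases hx with rfl | rfl <;> simp <;> tauto
    have := card_le_card hsub
    rwa [card_pair (mem_filter.1 hb.1).2.2] at this)
  have hle : #(W \ A) ≤ #(W ∩ A) := by
    refine card_le_card_of_injOn m ?_ ?_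
    · intro x hx
      simp only [coe_sdiff, Set.mem_sdiff, mem_coe] at hx
      have h1 := hA (h x (hWS x hx.1)).2.1
      simp only [coe_inter, Set.mem_inter_iff, mem_coe]
      exact ⟨(hWm x hx.1).1, by tauto⟩
    · intro x hx y hy hxy
      simp only [coe_sdiff, Set.mem_sdiff, mem_coe] at hx hy
      exact h.injOn (hWS x hx.1) (hWS y hy.1) hxy
  omega

/-- The sets of `k` leaves whose complement has a perfect matching. -/
noncomputable def avoidableSets (G : SimpleGraph V) (k : ℕ) : Finset (Finset V) :=
  univ.filter fun S => #S = k ∧ (∀ v ∈ S, G.IsLeafVertex v) ∧ ∃ m, G.CoversOff S m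

lemma mem_avoidableSets {k : ℕ} {S : Finset V} : S ∈ G.avoidableSets k ↔
    #S = k ∧ (∀ v ∈ S, G.IsLeafVertex v) ∧ ∃ m, G.CoversOff S m := by
  simp [avoidableSets]

lemma Subgraph.IsMatching.exists_coversOff {M : G.Subgraph} (hM : M.IsMatching) :
    ∃ m, G.CoversOff M.vertsᶜ.toFinset m ∧ ∀ x y, M.Adj x y ↔ x ∈ M.verts ∧ y = m x := by
  have h : ∀ v, ∃ w, v ∈ M.verts → M.Adj v w := by
    intro v
    by_cases hv : v ∈ M.verts
    · obtain ⟨w, hw, -⟩ := hM hv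
      exact ⟨w, fun _ => hw⟩
    · exact ⟨v, fun h => absurd h hv⟩
  choose m hm using h
  refine ⟨m, fun v hv => ?_, fun x y => ⟨fun hxy => ?_, ?_⟩⟩
  · simp only [Set.mem_toFinset, Set.mem_compl_iff, not_not] at hv ⊢
    have h1 := hm v hv
    have h2 := hm (m v) (M.edge_vert h1.symm)
    exact ⟨M.edge_vert h1.symm, M.adj_sub h1, hM.eq_of_adj_left h2 h1.symm⟩
  · have hx := M.edge_vert hxy
    exact ⟨hx, hM.eq_of_adj_left hxy (hm x hx)⟩
  · rintro ⟨hx, rfl⟩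
    exact hm x hx

lemma CoversOff.exists_isMatching {S : Finset V} {m : V → V} (h : G.CoversOff S m) :
    ∃ M : G.Subgraph, M.IsMatching ∧ M.vertsᶜ = (S : Set V) := by
  refine ⟨⟨{v | v ∉ S}, fun v w => v ∉ S ∧ w = m v, ?_, ?_, ⟨?_⟩⟩, ?_, ?_⟩
  · rintro v w ⟨hv, rfl⟩
    exact (h v hv).2.1
  · rintro v w ⟨hv, rfl⟩
    exact hv
  · rintro v w ⟨hv, rfl⟩
    exact ⟨(h v hv).1, (h v hv).2.2.symm⟩
  · intro v hv
    exact ⟨m v, ⟨hv, rfl⟩, fun y hy => hy.2⟩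
  · ext v
    simp

/-- The matching is recovered from its uncovered set, because a tree has at most one perfect
matching off that set. -/
lemma IsTree.numSAPM_eq (hG : G.IsTree) :
    G.numSAPM = #(G.avoidableSets (if Even (Nat.card V) then 2 else 1)) := by
  unfold numSAPM
  rw [← Set.ncard_coe_finset]
  refine Set.ncard_congr (fun M _ => M.vertsᶜ.toFinset) ?_ ?_ ?_
  · rintro M ⟨h1, h2, h3⟩
    rw [mem_coe, mem_avoidableSets]
    obtain ⟨m, hm, -⟩ := h1.exists_coversOff
    refine ⟨?_, ?_, m, hm⟩
    · rw [← h2, Set.ncard_eq_toFinset_card']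
    · intro v hv
      exact h3 v (by simpa using hv)
  · intro M M' hM hM' heq
    obtain ⟨m, hm, ha⟩ := hM.1.exists_coversOff
    obtain ⟨m', hm', ha'⟩ := hM'.1.exists_coversOff
    have hverts : M.verts = M'.verts := by
      have := congrArg (fun s : Finset V => (s : Set V)) heq
      simpa using this
    ext x y
    · rw [hverts]
    · rw [ha, ha', hverts]
      have heq' : M.vertsᶜ.toFinset = M'.vertsᶜ.toFinset := heq
      rw [← heq'] at hm'
      constructor
      · rintro ⟨h1, rfl⟩
        exact ⟨h1, hm.unique hG hm' (by simpa [hverts] using h1)⟩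
      · rintro ⟨h1, rfl⟩
        exact ⟨h1, (hm.unique hG hm' (by simpa [hverts] using h1)).symm⟩
  · intro S hS
    rw [mem_coe, mem_avoidableSets] at hS
    obtain ⟨h1, h2, m, hm⟩ := hS
    obtain ⟨M, hM, hv⟩ := hm.exists_isMatching
    refine ⟨M, ⟨hM, ?_, ?_⟩, ?_⟩
    · rw [hv, Set.ncard_coe_finset, h1]
    · intro v hvM
      refine h2 v ?_
      have : v ∈ M.vertsᶜ := hvM
      rwa [hv] at this
    · ext v
      simp only [Set.mem_toFinset, hv, mem_coe]


/-! ### Recognising trees: spiders, spider-trios and double brooms -/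

/-- A connected graph that maps bijectively to a tree is isomorphic to it. -/
lemma IsTree.nonempty_iso_of_surjective {W : Type*} [Fintype W] {H : SimpleGraph W}
    (hG : G.IsTree) (hH : H.Connected) (f : W → V) (hf : ∀ x y, H.Adj x y → G.Adj (f x) (f y))
    (hsurj : Function.Surjective f) (hcard : Fintype.card W ≤ Fintype.card V) :
    Nonempty (G ≃g H) := by
  have hbij : Function.Bijective f :=
    (Fintype.bijective_iff_surjective_and_card f).2
      ⟨hsurj, le_antisymm hcard (Fintype.card_le_of_surjective f hsurj)⟩
  let e := Equiv.ofBijective f hbij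
  have hconn : (H.comap e.symm).Connected := (Iso.comap e.symm H).connected_iff.2 hH
  have hle : H.comap e.symm ≤ G := by
    intro x y hxy
    have := hf _ _ (comap_adj.1 hxy)
    rwa [show f (e.symm x) = x from e.apply_symm_apply x,
      show f (e.symm y) = y from e.apply_symm_apply y] at this
  -- A tree is minimal among connected graphs on its vertices, so the connected subgraph transported
  -- from `H` is all of `G`.
  have heq := le_antisymm ((isTree_iff_minimal_connected.1 hG).2 hconn hle) hle
  rw [heq]
  exact ⟨Iso.comap e.symm H⟩

lemma connected_of_parent (r : V) (p : V → V) (d : V → ℕ) (hd : ∀ x, x ≠ r → d (p x) < d x)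
    (hp : ∀ x, x ≠ r → G.Adj x (p x)) : G.Connected := by
  have key : ∀ n x, d x = n → G.Reachable x r := by
    intro n
    induction n using Nat.strong_induction_on with
    | _ n ih =>
      intro x hx
      by_cases hxr : x = r
      · rw [hxr]
      · exact (hp x hxr).reachable.trans (ih _ (hx ▸ hd x hxr) _ rfl)
  have : Nonempty V := ⟨r⟩
  exact ⟨fun x y => (key _ x rfl).trans (key _ y rfl).symm⟩

/-- Every edge joins some `x ≠ r` to `p x`, so there are at most `#V - 1` edges; connectedness comes
from following parents down to the root. -/
lemma isTree_of_parent (r : V) (p : V → V) (d : V → ℕ) (hd : ∀ x, x ≠ r → d (p x) < d x)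
    (hp : ∀ x, x ≠ r → G.Adj x (p x))
    (hr : p r = r)
    (hall : ∀ x y, G.Adj x y → y = p x ∨ x = p y) : G.IsTree := by
  have hconn := connected_of_parent r p d hd hp
  refine isTree_iff_connected_and_card.2 ⟨hconn, le_antisymm ?_
    hconn.card_vert_le_card_edgeSet_add_one⟩
  have hsub : G.edgeFinset ⊆ (univ.erase r).image fun x => s(x, p x) := by
    intro e he
    induction e using Sym2.ind with
    | _ x y =>
      rw [mem_edgeFinset, mem_edgeSet] at he
      rcases hall x y he with rfl | rfl
      · exact mem_image.2 ⟨x, by simpa using fun h => he.ne (by rw [h, hr]), rfl⟩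
      · exact mem_image.2 ⟨y, by simpa using fun h => he.ne (by rw [h, hr]), Sym2.eq_swap⟩
  have h1 := (card_le_card hsub).trans card_image_le
  rw [card_erase_of_mem (mem_univ r), card_univ] at h1
  have h2 : Nat.card G.edgeSet = #G.edgeFinset := by
    rw [Nat.card_eq_fintype_card, edgeFinset_card]
  have h3 : 0 < Fintype.card V := Fintype.card_pos_iff.2 ⟨r⟩
  rw [h2, Nat.card_eq_fintype_card]
  omega

/-- The neighbour towards the centre in a spider. -/
def spiderParent {k : ℕ} : Option (Fin k × Bool) → Option (Fin k × Bool)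
  | none => none
  | some (_, false) => none
  | some (i, true) => some (i, false)

/-- The distance from the centre in a spider. -/
def spiderDepth {k : ℕ} : Option (Fin k × Bool) → ℕ
  | none => 0
  | some (_, false) => 1
  | some (_, true) => 2

lemma spiderDepth_lt {k : ℕ} : ∀ x : Option (Fin k × Bool), x ≠ none →
    spiderDepth (spiderParent x) < spiderDepth x := by
  rintro (_ | ⟨i, _ | _⟩) h <;> simp [spiderDepth, spiderParent] at h ⊢

lemma spider_adj_parent {k : ℕ} : ∀ x : Option (Fin k × Bool), x ≠ none →
    (spider k).Adj x (spiderParent x) := by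
  rintro (_ | ⟨i, _ | _⟩) h <;> simp [spiderParent, spider] at h ⊢

lemma eq_spiderParent {k : ℕ} : ∀ x y : Option (Fin k × Bool), (spider k).Adj x y →
    (x ≠ none ∧ y = spiderParent x) ∨ (y ≠ none ∧ x = spiderParent y) := by
  rintro (_ | ⟨i, _ | _⟩) (_ | ⟨j, _ | _⟩) h <;> simp [spider, spiderParent] at h ⊢ <;> tauto

lemma spider_isTree (k : ℕ) : (spider k).IsTree :=
  isTree_of_parent none spiderParent spiderDepth spiderDepth_lt spider_adj_parent rfl
    fun x y h => (eq_spiderParent x y h).imp And.right And.right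

lemma spiderTrio_isTree (a b c : ℕ) : (spiderTrio a b c).IsTree := by
  refine isTree_of_parent none
    (fun | none => none
         | some (.inl x) => if x = none then none else some (.inl (spiderParent x))
         | some (.inr (.inl x)) => if x = none then none else some (.inr (.inl (spiderParent x)))
         | some (.inr (.inr x)) => if x = none then none else some (.inr (.inr (spiderParent x))))
    (fun | none => 0
         | some (.inl x) => spiderDepth x + 1
         | some (.inr (.inl x)) => spiderDepth x + 1
         | some (.inr (.inr x)) => spiderDepth x + 1) ?_ ?_ rfl ?_
  · rintro (_ | (x | (x | x))) h
    · exact absurd rfl h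
    all_goals
      by_cases hx : x = none
      · simp [hx]
      · simpa [hx] using spiderDepth_lt x hx
  · rintro (_ | (x | (x | x))) h
    · exact absurd rfl h
    all_goals
      by_cases hx : x = none
      · simp [hx, spiderTrio, addVertex]
      · simpa [hx, spiderTrio, addVertex] using spider_adj_parent x hx
  · rintro (_ | (x | (x | x))) (_ | (y | (y | y))) h <;>
      simp only [spiderTrio, addVertex, Set.mem_insert_iff, Set.mem_singleton_iff, Sum.inl.injEq,
        Sum.inr.injEq, reduceCtorEq, or_false, false_or, sum_adj] at h
    all_goals first
      | simpa using eq_spiderParent x y h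
      | simp [h]

lemma doubleBroom_isTree (a b : ℕ) : (doubleBroom a b).IsTree := by
  refine isTree_of_parent (.inl none)
    (fun | .inl _ => .inl none | .inr none => .inl none | .inr (some _) => .inr none)
    (fun | .inl none => 0 | .inl (some _) => 1 | .inr none => 1 | .inr (some _) => 2) ?_ ?_ rfl ?_
  · rintro ((_ | i) | (_ | i)) h <;> simp at h ⊢
  · rintro ((_ | i) | (_ | i)) h <;> simp [doubleBroom, starGraph, edge_adj] at h ⊢
  · rintro ((_ | i) | (_ | i)) ((_ | j) | (_ | j)) h <;>
      simp [doubleBroom, starGraph, edge_adj] at h ⊢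

lemma card_spider (k : ℕ) : Fintype.card (Option (Fin k × Bool)) = 2 * k + 1 := by
  simp [mul_comm]

lemma card_spiderTrio (a b c : ℕ) :
    Fintype.card (Option (Option (Fin a × Bool) ⊕
      (Option (Fin b × Bool) ⊕ Option (Fin c × Bool)))) = 2 * (a + b + c) + 4 := by
  simp; ring


/-! ### Neighbourhoods and tight sets -/

/-- The set of vertices with a neighbour in `X`. -/
noncomputable def nbrs (G : SimpleGraph V) (X : Finset V) : Finset V :=
  univ.filter fun v => ∃ x ∈ X, G.Adj x v

lemma mem_nbrs {X : Finset V} {v : V} : v ∈ G.nbrs X ↔ ∃ x ∈ X, G.Adj x v := by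
  simp [nbrs]

lemma nbrs_mono {X Y : Finset V} (h : X ⊆ Y) : G.nbrs X ⊆ G.nbrs Y := by
  intro v hv
  obtain ⟨x, hx, ha⟩ := mem_nbrs.1 hv
  exact mem_nbrs.2 ⟨x, h hx, ha⟩

lemma IsColourClass.nbrs_disjoint {A X : Finset V} (hA : G.IsColourClass A) (hX : X ⊆ A) :
    Disjoint X (G.nbrs X) := by
  rw [Finset.disjoint_left]
  intro v hv hv'
  obtain ⟨x, hx, ha⟩ := mem_nbrs.1 hv'
  exact (hA ha).1 (hX hx) (hX hv)

lemma IsColourClass.nbrs_subset {A X : Finset V} (hA : G.IsColourClass A) (hX : X ⊆ A) :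
    G.nbrs X ⊆ Aᶜ := by
  intro v hv
  obtain ⟨x, hx, ha⟩ := mem_nbrs.1 hv
  exact mem_compl.2 ((hA ha).1 (hX hx))

lemma CoversOff.card_sdiff_le {S : Finset V} {m : V → V} (h : G.CoversOff S m) (X : Finset V) :
    #(X \ S) ≤ #(G.nbrs X) := by
  refine card_le_card_of_injOn m ?_ ?_
  · intro x hx
    simp only [coe_sdiff, Set.mem_sdiff, mem_coe] at hx
    exact mem_coe.2 (mem_nbrs.2 ⟨x, hx.1, (h x hx.2).2.1⟩)
  · intro x hx y hy hxy
    simp only [coe_sdiff, Set.mem_sdiff, mem_coe] at hx hy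
    exact h.injOn hx.2 hy.2 hxy

/-- The easy half of Hall's theorem: if `X` missed `S`, the matching would inject `X` into its
neighbourhood. -/
lemma CoversOff.exists_mem_of_card_lt {S : Finset V} {m : V → V} (h : G.CoversOff S m)
    {X : Finset V} (hX : #(G.nbrs X) < #X) : ∃ x ∈ X, x ∈ S := by
  by_contra! hc
  have h1 := h.card_sdiff_le X
  rw [sdiff_eq_self_of_disjoint (Finset.disjoint_left.2 hc)] at h1
  omega

/-- An inclusion-minimal set with `k` more vertices than neighbours. -/
def IsTight (G : SimpleGraph V) (k : ℕ) (D : Finset V) : Prop :=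
  #D = #(G.nbrs D) + k ∧ ∀ X ⊂ D, #X < #(G.nbrs X) + k

/-- In an inclusion-minimal set of excess at least `k`, the excess is exactly `k`: removing one
vertex lowers it by at most one. Positivity of `k` provides a vertex to remove. -/
lemma exists_isTight {k : ℕ} (hk : 0 < k) {X : Finset V} (hX : #(G.nbrs X) + k ≤ #X) :
    ∃ D ⊆ X, G.IsTight k D := by
  obtain ⟨D, hDX, hD⟩ := exists_minimal_le_of_wellFoundedLT
    (fun D : Finset V => #(G.nbrs D) + k ≤ #D) X hX
  refine ⟨D, hDX, le_antisymm ?_ hD.1, fun Y hY => ?_⟩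
  · by_contra! hlt
    have hne : D.Nonempty := card_pos.1 (by omega)
    obtain ⟨x, hx⟩ := hne
    have h1 := card_le_card (G.nbrs_mono (erase_subset x D))
    have h2 := card_erase_of_mem hx
    have := hD.2 (y := D.erase x) (by show _ + _ ≤ _; omega) (erase_subset x D) hx
    simp at this
  · by_contra! hle
    exact hY.2 (hD.2 hle hY.1)

/-- If `x` were the only neighbour of `b` in `D`, deleting `x` would remove `b` from the
neighbourhood, leaving a proper subset with excess at least `k`. -/
lemma IsTight.two_le_card {k : ℕ} {D : Finset V} (hD : G.IsTight k D) {b : V}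
    (hb : b ∈ G.nbrs D) : 2 ≤ #{x ∈ D | G.Adj b x} := by
  by_contra! hlt
  obtain ⟨x, hx, ha⟩ := mem_nbrs.1 hb
  have hmem : x ∈ {x ∈ D | G.Adj b x} := mem_filter.2 ⟨hx, ha.symm⟩
  have huniq : ∀ y ∈ D, G.Adj b y → y = x := by
    intro y hy hby
    exact card_le_one.1 (Nat.lt_succ_iff.1 hlt) _ (mem_filter.2 ⟨hy, hby⟩) _ hmem
  have h1 := hD.2 _ (erase_ssubset hx)
  have h2 : G.nbrs (D.erase x) ⊆ (G.nbrs D).erase b := by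
    intro v hv
    refine mem_erase.2 ⟨?_, G.nbrs_mono (erase_subset x D) hv⟩
    rintro rfl
    obtain ⟨y, hy, hyv⟩ := mem_nbrs.1 hv
    exact (mem_erase.1 hy).1 (huniq y (mem_erase.1 hy).2 hyv.symm)
  have h3 := card_le_card h2
  rw [card_erase_of_mem hb] at h3
  rw [card_erase_of_mem hx] at h1
  have h4 := hD.1
  have h5 : 0 < #(G.nbrs D) := card_pos.2 ⟨b, hb⟩
  omega

/-- The leaves in a set of vertices. -/
noncomputable def leavesIn (G : SimpleGraph V) (X : Finset V) : Finset V :=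
  X.filter fun v => G.IsLeafVertex v

lemma mem_leavesIn {X : Finset V} {v : V} : v ∈ G.leavesIn X ↔ v ∈ X ∧ G.IsLeafVertex v := by
  simp [leavesIn]

lemma leavesIn_subset {X : Finset V} : G.leavesIn X ⊆ X := filter_subset _ _

/-- If some vertex of `X` is not a leaf, at most `#X - 1 = #(G.nbrs X)` leaves remain. If all are
leaves, the neighbours own disjoint sets of at least two of them, so `2 * #(G.nbrs X) ≤ #(G.nbrs X)
+ 1` and `#X ≤ 2`. -/
lemma IsTight.card_leavesIn_le {X : Finset V} (hX : G.IsTight 1 X) :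
    #(G.leavesIn X) ≤ max #(G.nbrs X) 2 := by
  by_cases hall : G.leavesIn X = X
  · have hleaf : ∀ x ∈ X, G.IsLeafVertex x := fun x hx => by
      rw [← hall] at hx
      exact (mem_leavesIn.1 hx).2
    have hex : ∀ x, ∃ y, x ∈ X → G.Adj x y := fun x => by
      by_cases hx : x ∈ X
      · obtain ⟨w, hw⟩ := (hleaf x hx).exists_adj_iff
        exact ⟨w, fun _ => (hw w).2 rfl⟩
      · exact ⟨x, fun h => absurd h hx⟩
    choose f hf using hex
    have h1 : #X = ∑ b ∈ G.nbrs X, #{x ∈ X | f x = b} :=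
      card_eq_sum_card_fiberwise fun x hx => mem_coe.2 (mem_nbrs.2 ⟨x, hx, hf x hx⟩)
    have h2 := card_nsmul_le_sum (G.nbrs X) (fun b => #{x ∈ X | f x = b}) 2 (fun b hb => by
      refine (hX.two_le_card hb).trans (card_le_card ?_)
      intro x hx
      rw [mem_filter] at hx ⊢
      exact ⟨hx.1, (hleaf x hx.1).eq_of_adj (hf x hx.1) hx.2.symm⟩)
    have h3 := hX.1
    rw [hall]
    simp only [smul_eq_mul] at h2
    omega
  · have h1 : #(G.leavesIn X) < #X :=
      card_lt_card (Finset.ssubset_iff_subset_ne.2 ⟨leavesIn_subset, hall⟩)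
    have h2 := hX.1
    omega

lemma IsTree.nbrs_nonempty [Nontrivial V] (hG : G.IsTree) {X : Finset V} (hX : X.Nonempty) :
    (G.nbrs X).Nonempty := by
  obtain ⟨x, hx⟩ := hX
  by_contra hne
  rw [not_nonempty_iff_eq_empty] at hne
  have h := hG.connected.eq_univ_of_closed (singleton_nonempty x) (fun z hz y hy => by
    rw [mem_singleton] at hz
    subst hz
    have : y ∈ G.nbrs X := mem_nbrs.2 ⟨z, hx, hy⟩
    simp [hne] at this)
  obtain ⟨y, hy⟩ := exists_ne x
  have := mem_univ y
  rw [← h] at this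
  exact hy (mem_singleton.1 this)

/-! ### Separated pairs of tight sets -/

/-- The unordered pairs with one element in `X` and one in `Y`. -/
noncomputable def crossPairs (X Y : Finset V) : Finset (Finset V) :=
  (X ×ˢ Y).image fun p => {p.1, p.2}

lemma mem_crossPairs {X Y S : Finset V} :
    S ∈ crossPairs X Y ↔ ∃ x ∈ X, ∃ y ∈ Y, S = {x, y} := by
  simp only [crossPairs, mem_image, mem_product, Prod.exists]
  constructor
  · rintro ⟨x, y, ⟨hx, hy⟩, rfl⟩
    exact ⟨x, hx, y, hy, rfl⟩
  · rintro ⟨x, hx, y, hy, rfl⟩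
    exact ⟨x, y, ⟨hx, hy⟩, rfl⟩

lemma card_crossPairs_le (X Y : Finset V) : #(crossPairs X Y) ≤ #X * #Y :=
  card_image_le.trans (card_product _ _).le

lemma card_crossPairs {X Y : Finset V} (h : Disjoint X Y) : #(crossPairs X Y) = #X * #Y := by
  rw [crossPairs, card_image_of_injOn, card_product]
  rintro ⟨a, b⟩ hp ⟨c, d⟩ hq heq
  simp only [coe_product, Set.mem_prod, mem_coe] at hp hq
  have ha : a ∈ ({c, d} : Finset V) := by
    have : a ∈ ({a, b} : Finset V) := by simp
    rwa [show ({a, b} : Finset V) = {c, d} from heq] at this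
  have hb : b ∈ ({c, d} : Finset V) := by
    have : b ∈ ({a, b} : Finset V) := by simp
    rwa [show ({a, b} : Finset V) = {c, d} from heq] at this
  simp only [mem_insert, mem_singleton] at ha hb
  have h1 : a ≠ d := fun e => Finset.disjoint_left.1 h hp.1 (e ▸ hq.2)
  have h2 : b ≠ c := fun e => Finset.disjoint_left.1 h hq.1 (e ▸ hp.2)
  rw [Prod.mk.injEq]
  tauto

lemma eq_pair_of_card_two {S : Finset V} (hS : #S = 2) {x y : V} (hx : x ∈ S) (hy : y ∈ S)
    (hxy : x ≠ y) : S = {x, y} := by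
  symm
  apply eq_of_subset_of_card_le
  · intro z hz
    simp only [mem_insert, mem_singleton] at hz
    rcases hz with rfl | rfl <;> assumption
  · rw [hS, card_pair hxy]

/-- Two tight sets of excess one that are disjoint together with their neighbourhoods. -/
structure TightPair (G : SimpleGraph V) (X Y : Finset V) : Prop where
  left : G.IsTight 1 X
  right : G.IsTight 1 Y
  disj_left : Disjoint X (G.nbrs X)
  disj_right : Disjoint Y (G.nbrs Y)
  disj : Disjoint (X ∪ G.nbrs X) (Y ∪ G.nbrs Y)

lemma TightPair.card_le {X Y : Finset V} (h : G.TightPair X Y) :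
    2 * (#(G.nbrs X) + #(G.nbrs Y)) + 2 ≤ Fintype.card V := by
  have h1 := card_le_univ ((X ∪ G.nbrs X) ∪ (Y ∪ G.nbrs Y))
  rw [card_union_of_disjoint h.disj, card_union_of_disjoint h.disj_left,
    card_union_of_disjoint h.disj_right, h.left.1, h.right.1] at h1
  omega

/-- Each of the two sets has more vertices than neighbours, so each contains one of the two avoided
leaves. -/
lemma TightPair.avoidableSets_subset {X Y : Finset V} (h : G.TightPair X Y) :
    G.avoidableSets 2 ⊆ crossPairs (G.leavesIn X) (G.leavesIn Y) := by
  intro S hS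
  obtain ⟨h1, h2, m, hm⟩ := mem_avoidableSets.1 hS
  obtain ⟨x, hx, hxS⟩ := hm.exists_mem_of_card_lt (X := X) (by have := h.left.1; omega)
  obtain ⟨y, hy, hyS⟩ := hm.exists_mem_of_card_lt (X := Y) (by have := h.right.1; omega)
  have hxy : x ≠ y := fun e => Finset.disjoint_left.1 h.disj (mem_union_left _ hx)
    (mem_union_left _ (e ▸ hy))
  exact mem_crossPairs.2 ⟨x, mem_leavesIn.2 ⟨hx, h2 x hxS⟩, y, mem_leavesIn.2 ⟨hy, h2 y hyS⟩,
    eq_pair_of_card_two h1 hxS hyS hxy⟩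

lemma TightPair.card_avoidableSets_le {X Y : Finset V} (h : G.TightPair X Y) :
    #(G.avoidableSets 2) ≤ #(G.leavesIn X) * #(G.leavesIn Y) :=
  (card_le_card h.avoidableSets_subset).trans (card_crossPairs_le _ _)

/-- At order 6 each tight set has one neighbour and two vertices, and four avoidable pairs force all
four vertices to be leaves. Connectedness then joins the two neighbours. -/
lemma TightPair.nonempty_iso_doubleBroom [Nontrivial V] (hG : G.IsTree) {X Y : Finset V}
    (h : G.TightPair X Y) (hV : Fintype.card V = 6) (h4 : 4 ≤ #(G.avoidableSets 2)) :
    Nonempty (G ≃g doubleBroom 2 2) := by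
  have hX0 : X.Nonempty := card_pos.1 (by have := h.left.1; omega)
  have hY0 : Y.Nonempty := card_pos.1 (by have := h.right.1; omega)
  have hp : 0 < #(G.nbrs X) := card_pos.2 (hG.nbrs_nonempty hX0)
  have hq : 0 < #(G.nbrs Y) := card_pos.2 (hG.nbrs_nonempty hY0)
  have hle := h.card_le
  have hX := h.left.1
  have hY := h.right.1
  have hpX : #(G.nbrs X) = 1 := by omega
  have hpY : #(G.nbrs Y) = 1 := by omega
  have hcard := h4.trans h.card_avoidableSets_le
  have h1 := card_le_card (leavesIn_subset (G := G) (X := X))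
  have h2 := card_le_card (leavesIn_subset (G := G) (X := Y))
  have h3 : #(G.leavesIn X) = 2 ∧ #(G.leavesIn Y) = 2 := by
    constructor <;> nlinarith
  have hlX : G.leavesIn X = X := eq_of_subset_of_card_le leavesIn_subset (by omega)
  have hlY : G.leavesIn Y = Y := eq_of_subset_of_card_le leavesIn_subset (by omega)
  obtain ⟨b, hb⟩ := card_eq_one.1 hpX
  obtain ⟨c, hc⟩ := card_eq_one.1 hpY
  have hbX : ∀ x ∈ X, G.Adj b x := fun x hx => by
    rw [← hlX] at hx
    obtain ⟨w, hw⟩ := (mem_leavesIn.1 hx).2.exists_adj_iff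
    have hxw := (hw w).2 rfl
    have : w ∈ G.nbrs X := mem_nbrs.2 ⟨x, (mem_leavesIn.1 hx).1, hxw⟩
    rw [hb, mem_singleton] at this
    exact (this ▸ hxw).symm
  have hcY : ∀ x ∈ Y, G.Adj c x := fun x hx => by
    rw [← hlY] at hx
    obtain ⟨w, hw⟩ := (mem_leavesIn.1 hx).2.exists_adj_iff
    have hxw := (hw w).2 rfl
    have : w ∈ G.nbrs Y := mem_nbrs.2 ⟨x, (mem_leavesIn.1 hx).1, hxw⟩
    rw [hc, mem_singleton] at this
    exact (this ▸ hxw).symm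
  have huniv : (X ∪ G.nbrs X) ∪ (Y ∪ G.nbrs Y) = univ := by
    apply eq_univ_of_card
    rw [card_union_of_disjoint h.disj, card_union_of_disjoint h.disj_left,
      card_union_of_disjoint h.disj_right]
    omega
  have hcov : ∀ v, v ∈ X ∨ v = b ∨ v ∈ Y ∨ v = c := fun v => by
    have := mem_univ v
    rw [← huniv, hb, hc] at this
    simp only [mem_union, mem_singleton] at this
    tauto
  have hdisj := h.disj
  rw [hb, hc, Finset.disjoint_left] at hdisj
  have hbc : G.Adj b c := by
    by_contra hnot
    have hcl := hG.connected.eq_univ_of_closed (C := X ∪ {b}) ⟨b, by simp⟩ (fun x hx y hxy => by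
      rw [mem_union, mem_singleton] at hx ⊢
      rcases hx with hx | rfl
      · right
        have : y ∈ G.nbrs X := mem_nbrs.2 ⟨x, hx, hxy⟩
        rwa [hb, mem_singleton] at this
      · rcases hcov y with hy | hy | hy | rfl
        · exact .inl hy
        · exact .inr hy
        · have : x ∈ G.nbrs Y := mem_nbrs.2 ⟨y, hy, hxy.symm⟩
          rw [hc] at this
          exact absurd (mem_union_right _ this) (hdisj (by simp))
        · exact absurd hxy hnot)
    have : c ∈ X ∪ {b} := by rw [hcl]; exact mem_univ c
    exact hdisj this (by simp)
  have eX : Fin 2 ≃ X := (finCongr (by rw [Fintype.card_coe]; omega)).trans (Fintype.equivFin X).symm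
  have eY : Fin 2 ≃ Y := (finCongr (by rw [Fintype.card_coe]; omega)).trans (Fintype.equivFin Y).symm
  refine hG.nonempty_iso_of_surjective (doubleBroom_isTree 2 2).connected
    (fun | .inl none => b | .inl (some i) => eX i | .inr none => c | .inr (some i) => eY i)
    ?_ ?_ (by simp [hV])
  · rintro ((_ | i) | (_ | i)) ((_ | j) | (_ | j)) hadj <;>
      simp [doubleBroom, starGraph, edge_adj] at hadj ⊢
    · exact hbX _ (eX j).2
    · exact hbc
    · exact (hbX _ (eX i).2).symm
    · exact hbc.symm
    · exact hcY _ (eY j).2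
    · exact (hcY _ (eY i).2).symm
  · intro v
    rcases hcov v with hv | rfl | hv | rfl
    · exact ⟨.inl (some (eX.symm ⟨v, hv⟩)), by simp⟩
    · exact ⟨.inl none, rfl⟩
    · exact ⟨.inr (some (eY.symm ⟨v, hv⟩)), by simp⟩
    · exact ⟨.inr none, rfl⟩

/-- The bound on the number of avoidable pairs in the presence of a tight pair. -/
lemma TightPair.exists_bound [Nontrivial V] (hG : G.IsTree) {X Y : Finset V} (h : G.TightPair X Y) :
    ∃ p q, 0 < p ∧ 0 < q ∧ 2 * (p + q) + 2 ≤ Fintype.card V ∧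
      #(G.avoidableSets 2) ≤ max p 2 * max q 2 ∧
      (Fintype.card V = 6 → 4 ≤ #(G.avoidableSets 2) → Nonempty (G ≃g doubleBroom 2 2)) := by
  have hX0 : X.Nonempty := card_pos.1 (by have := h.left.1; omega)
  have hY0 : Y.Nonempty := card_pos.1 (by have := h.right.1; omega)
  exact ⟨#(G.nbrs X), #(G.nbrs Y), card_pos.2 (hG.nbrs_nonempty hX0),
    card_pos.2 (hG.nbrs_nonempty hY0), h.card_le,
    h.card_avoidableSets_le.trans
      (Nat.mul_le_mul h.left.card_leavesIn_le h.right.card_leavesIn_le),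
    h.nonempty_iso_doubleBroom hG⟩


/-! ### Colour classes of equal size -/

lemma CoversOff.card_sdiff_le_compl {S A : Finset V} {m : V → V} (h : G.CoversOff S m)
    (hA : G.IsColourClass A) : #(A \ S) ≤ #(Aᶜ \ S) := by
  refine card_le_card_of_injOn m ?_ ?_
  · intro x hx
    simp only [coe_sdiff, Set.mem_sdiff, mem_coe] at hx
    have h1 := h x hx.2
    simp only [mem_coe, mem_sdiff, mem_compl]
    exact ⟨(hA h1.2.1).1 hx.1, h1.1⟩
  · intro x hx y hy hxy
    simp only [coe_sdiff, Set.mem_sdiff, mem_coe] at hx hy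
    exact h.injOn hx.2 hy.2 hxy

/-- The matching pairs `A \ S` with `Aᶜ \ S`, so the sizes of the classes determine how `S` splits
between them. -/
lemma CoversOff.card_add_card_inter {S A : Finset V} {m : V → V} (h : G.CoversOff S m)
    (hA : G.IsColourClass A) : #A + #(Aᶜ ∩ S) = #Aᶜ + #(A ∩ S) := by
  have h1 := h.card_sdiff_le_compl hA
  have h2 := h.card_sdiff_le_compl hA.compl
  rw [compl_compl] at h2
  have h3 := card_sdiff_add_card_inter A S
  have h4 := card_sdiff_add_card_inter Aᶜ S
  omega

lemma card_inter_add_card_compl_inter (A S : Finset V) : #(A ∩ S) + #(Aᶜ ∩ S) = #S := by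
  rw [← card_union_of_disjoint, ← union_inter_distrib_right, union_compl, univ_inter]
  exact disjoint_compl_right.mono inter_subset_left inter_subset_left

/-- Hall's theorem gives an injection from `A` along edges; it fills `Aᶜ` because the classes have
equal size. -/
lemma IsColourClass.exists_coversOff_empty {A : Finset V} (hA : G.IsColourClass A)
    (hcard : #A = #Aᶜ) (h : ∀ X ⊆ A, #X ≤ #(G.nbrs X)) : ∃ m, G.CoversOff ∅ m := by
  obtain ⟨f, hf, hfa⟩ := (all_card_le_biUnion_card_iff_exists_injective
    (fun a : A => univ.filter fun v => G.Adj a v)).1 (fun s => by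
      have h1 := h (s.map (Function.Embedding.subtype _)) (by
        intro x hx
        obtain ⟨y, -, rfl⟩ := mem_map.1 hx
        exact y.2)
      rw [card_map] at h1
      refine h1.trans (card_le_card fun v hv => ?_)
      obtain ⟨x, hx, hxv⟩ := mem_nbrs.1 hv
      obtain ⟨y, hy, rfl⟩ := mem_map.1 hx
      exact mem_biUnion.2 ⟨y, hy, by simpa using hxv⟩)
  have hadj : ∀ a : A, G.Adj a (f a) := fun a => by simpa using hfa a
  have himg : univ.image f = Aᶜ := by
    apply eq_of_subset_of_card_le
    · intro v hv
      obtain ⟨a, -, rfl⟩ := mem_image.1 hv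
      exact mem_compl.2 ((hA (hadj a)).1 a.2)
    · rw [card_image_of_injective _ hf, card_univ, Fintype.card_coe, hcard]
  have hinv : ∀ v, ∃ a, v ∉ A → ∃ h : a ∈ A, f ⟨a, h⟩ = v := fun v => by
    by_cases hv : v ∈ A
    · exact ⟨v, fun h => absurd hv h⟩
    · have : v ∈ univ.image f := by rw [himg]; exact mem_compl.2 hv
      obtain ⟨a, -, rfl⟩ := mem_image.1 this
      exact ⟨a, fun _ => ⟨a.2, rfl⟩⟩
  choose g hg using hinv
  refine ⟨fun v => if h : v ∈ A then f ⟨v, h⟩ else g v, fun v _ => ⟨notMem_empty _, ?_⟩⟩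
  by_cases hv : v ∈ A
  · have h1 := hadj ⟨v, hv⟩
    have h2 : f ⟨v, hv⟩ ∉ A := (hA h1).1 hv
    obtain ⟨h3, h4⟩ := hg _ h2
    have h5 := hf h4
    simp only [hv, h2, dif_pos, dif_neg, not_false_iff]
    exact ⟨h1, congrArg Subtype.val h5⟩
  · obtain ⟨h3, h4⟩ := hg v hv
    have h1 := hadj ⟨_, h3⟩
    rw [h4] at h1
    simp only [hv, h3, dif_pos, dif_neg, not_false_iff]
    exact ⟨h1.symm, h4⟩

lemma IsColourClass.avoidableSets_subset {A : Finset V} (hA : G.IsColourClass A)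
    (hcard : #A = #Aᶜ) {S : Finset V} (hS : S ∈ G.avoidableSets 2) :
    #(A ∩ S) = 1 ∧ #(Aᶜ ∩ S) = 1 ∧ ∃ u ∈ G.leavesIn A, ∃ v ∈ G.leavesIn Aᶜ, S = {u, v} := by
  obtain ⟨h1, h2, m, hm⟩ := mem_avoidableSets.1 hS
  have h3 := hm.card_add_card_inter hA
  have h4 := card_inter_add_card_compl_inter A S
  have h5 : #(A ∩ S) = 1 := by omega
  have h6 : #(Aᶜ ∩ S) = 1 := by omega
  refine ⟨h5, h6, ?_⟩
  obtain ⟨u, hu⟩ := card_eq_one.1 h5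
  obtain ⟨v, hv⟩ := card_eq_one.1 h6
  have hu' : u ∈ A ∩ S := by simp [hu]
  have hv' : v ∈ Aᶜ ∩ S := by simp [hv]
  rw [mem_inter] at hu' hv'
  exact ⟨u, mem_leavesIn.2 ⟨hu'.1, h2 u hu'.2⟩, v, mem_leavesIn.2 ⟨hv'.1, h2 v hv'.2⟩,
    eq_pair_of_card_two h1 hu'.2 hv'.2 fun e => mem_compl.1 hv'.1 (e ▸ hu'.1)⟩

/-- Leaves are matched to non-leaves, so at most half of the vertices are leaves. Below that
extreme, the numbers of leaves in the two classes sum to at most `s + 1`. At the extreme, every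
non-leaf carries exactly one matched leaf, and an avoided pair must come from two adjacent
non-leaves. -/
lemma CoversOff.card_avoidableSets_le (hG : G.IsTree) {A : Finset V} (hA : G.IsColourClass A)
    (hcard : #A = #Aᶜ) {m : V → V} (hm : G.CoversOff ∅ m) {s : ℕ}
    (hV : Fintype.card V = 2 * s + 4) :
    #(G.avoidableSets 2) ≤ s + 1 ∨ ∃ x y, x + y ≤ s + 1 ∧ #(G.avoidableSets 2) ≤ x * y := by
  replace hm : ∀ v, G.Adj v (m v) ∧ m (m v) = v := fun v => (hm v (notMem_empty v)).2
  have hminj : Function.Injective m := fun x y hxy => by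
    rw [← (hm x).2, ← (hm y).2, hxy]
  set L := G.leavesIn univ with hL
  have hmemL : ∀ x, x ∈ L ↔ G.IsLeafVertex x := fun x => by simp [hL, mem_leavesIn]
  have hmL : ∀ x ∈ L, m x ∉ L := by
    intro x hx hx'
    rw [hmemL] at hx hx'
    have hcl := hG.connected.eq_univ_of_closed (C := {x, m x}) ⟨x, by simp⟩ (fun z hz y hy => by
      rw [mem_insert, mem_singleton] at hz ⊢
      rcases hz with rfl | rfl
      · exact .inr (hx.eq_of_adj hy (hm z).1)
      · exact .inl (hx'.eq_of_adj hy (hm x).1.symm))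
    have h1 : #({x, m x} : Finset V) ≤ 2 := card_le_two
    rw [hcl, card_univ] at h1
    omega
  have himg : L.image m ⊆ Lᶜ := by
    intro v hv
    obtain ⟨x, hx, rfl⟩ := mem_image.1 hv
    exact mem_compl.2 (hmL x hx)
  have hcimg : #(L.image m) = #L := card_image_of_injective _ hminj
  have h1 := card_le_card himg
  have h2 := card_compl_add_card L
  have hsum : #(G.leavesIn A) + #(G.leavesIn Aᶜ) = #L := by
    rw [← card_union_of_disjoint]
    · congr 1
      ext v
      simp only [mem_union, mem_leavesIn, hmemL, mem_compl]
      tauto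
    · exact disjoint_compl_right.mono leavesIn_subset leavesIn_subset
  by_cases hlt : #L ≤ s + 1
  · right
    refine ⟨_, _, hsum.le.trans hlt, (card_le_card ?_).trans (card_crossPairs_le _ _)⟩
    intro S hS
    exact mem_crossPairs.2 (hA.avoidableSets_subset hcard hS).2.2
  · left
    have himg' : L.image m = Lᶜ := eq_of_subset_of_card_le himg (by omega)
    set P := ((Lᶜ \ A) ×ˢ (Lᶜ ∩ A)).filter fun p => G.Adj p.1 p.2 with hP
    have hdisj : Disjoint (Lᶜ ∩ A) (Lᶜ \ A) := by
      rw [Finset.disjoint_left]; intro x; simp; tauto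
    have hunion : Lᶜ ∩ A ∪ Lᶜ \ A = Lᶜ := by
      ext x; simp; tauto
    have hc := hG.isAcyclic.card_filter_adj_lt hdisj (by
      rw [hunion]; exact card_pos.1 (by omega)) (P := P) (by
      intro p hp
      rw [hP, mem_filter, mem_product] at hp
      tauto)
    rw [← card_union_of_disjoint hdisj, hunion] at hc
    -- When `u` and `v` are avoided, `m u` needs a new partner. It is not a leaf, as its only
    -- possible leaf partner is `u`; so it is `m l` for a leaf `l`. That leaf has lost its only
    -- neighbour, hence is itself avoided, and `l = v`.
    have hsub : G.avoidableSets 2 ⊆ P.image fun p => {m p.1, m p.2} := by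
      intro S hS
      obtain ⟨-, -, u, hu, v, hv, rfl⟩ := hA.avoidableSets_subset hcard hS
      obtain ⟨-, -, m', hm'⟩ := mem_avoidableSets.1 hS
      rw [mem_leavesIn] at hu hv
      have huL := (hmemL u).2 hu.2
      have hvL := (hmemL v).2 hv.2
      have hmu : m u ∉ ({u, v} : Finset V) := by
        rw [mem_insert, mem_singleton]
        rintro (h | h)
        · exact (hm u).1.ne h.symm
        · exact hmL u huL (h ▸ hvL)
      have h3 := hm' _ hmu
      have hw : m' (m u) ∈ Lᶜ := by
        rw [mem_compl]
        intro hw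
        have h4 := ((hmemL _).1 hw).eq_of_adj h3.2.1.symm (hm _).1
        have h5 : m' (m u) = u := (hminj h4).symm
        rw [h5] at h3
        exact h3.1 (by simp)
      rw [← himg', mem_image] at hw
      obtain ⟨l, hl, hlw⟩ := hw
      have hlS : l ∈ ({u, v} : Finset V) := by
        by_contra hlS
        have h4 := hm' l hlS
        have h5 := ((hmemL l).1 hl).eq_of_adj h4.2.1 (hm l).1
        have h6 : m' l = m' (m u) := h5.trans hlw
        have h7 : l = m u := by rw [← h4.2.2, h6, h3.2.2]
        exact hmL u huL (h7 ▸ hl)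
      have hadj : G.Adj (m u) (m v) := by
        rw [mem_insert, mem_singleton] at hlS
        rcases hlS with rfl | rfl
        · exact absurd hlw.symm h3.2.1.ne'
        · rw [hlw]; exact h3.2.1
      have hmuA := (hA (hm u).1).1 hu.1
      have hmvA : m v ∈ A := by
        have := hA (hm v).1
        have := mem_compl.1 hv.1
        tauto
      refine mem_image.2 ⟨(m u, m v), ?_, ?_⟩
      · simp only [hP, mem_filter, mem_product, mem_sdiff, mem_inter, mem_compl]
        exact ⟨⟨⟨hmL u huL, hmuA⟩, hmL v hvL, hmvA⟩, hadj⟩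
      · simp only [(hm u).2, (hm v).2]
    have := (card_le_card hsub).trans card_image_le
    omega

/-- Only one vertex of `S` lies in `Aᶜ`, so the matching sends `Y \ S` onto `G.nbrs Y`. If `X` met
`G.nbrs Y`, the matching would send the overlap injectively into `G.nbrs X ∩ Y`; deleting the
overlap from `X` would then lose at least as many neighbours as vertices, against the minimality of
`X`. All other intersections are excluded by the colouring or by symmetry of adjacency. -/
lemma IsColourClass.tightPair {A X Y : Finset V} (hA : G.IsColourClass A) (hcard : #A = #Aᶜ)
    (hXA : X ⊆ A) (hYA : Y ⊆ Aᶜ) (hX : G.IsTight 1 X) (hY : G.IsTight 1 Y) {S : Finset V}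
    (hS : S ∈ G.avoidableSets 2) : G.TightPair X Y := by
  obtain ⟨hSA, hSA', -⟩ := hA.avoidableSets_subset hcard hS
  obtain ⟨-, -, m, hm⟩ := mem_avoidableSets.1 hS
  have hcov : ∀ w ∈ G.nbrs Y, ∃ y ∈ Y \ S, m y = w := by
    have himg : (Y \ S).image m = G.nbrs Y := by
      apply eq_of_subset_of_card_le
      · intro w hw
        obtain ⟨y, hy, rfl⟩ := mem_image.1 hw
        rw [mem_sdiff] at hy
        exact mem_nbrs.2 ⟨y, hy.1, (hm y hy.2).2.1⟩
      · rw [card_image_of_injOn]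
        · have h1 := card_sdiff_add_card_inter Y S
          have h2 := card_le_card (inter_subset_inter_right hYA (u := S))
          have h3 := hY.1
          omega
        · intro x hx y hy hxy
          simp only [coe_sdiff, Set.mem_sdiff, mem_coe] at hx hy
          exact hm.injOn hx.2 hy.2 hxy
    intro w hw
    rw [← himg] at hw
    simpa using hw
  have hXNY : Disjoint X (G.nbrs Y) := by
    rw [disjoint_iff_inter_eq_empty]
    by_contra hne
    obtain ⟨k, hk⟩ := nonempty_iff_ne_empty.2 hne
    have hKL : #(X ∩ G.nbrs Y) ≤ #(G.nbrs X ∩ Y) := by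
      have hKS : ∀ x ∈ X ∩ G.nbrs Y, x ∉ S ∧ m x ∈ G.nbrs X ∩ Y := by
        intro x hx
        rw [mem_inter] at hx
        obtain ⟨y, hy, rfl⟩ := hcov x hx.2
        rw [mem_sdiff] at hy
        have h1 := hm y hy.2
        rw [h1.2.2]
        exact ⟨h1.1, mem_inter.2 ⟨mem_nbrs.2 ⟨_, hx.1, h1.2.1.symm⟩, hy.1⟩⟩
      refine card_le_card_of_injOn m (fun x hx => mem_coe.2 (hKS x (mem_coe.1 hx)).2) ?_
      intro x hx y hy hxy
      exact hm.injOn (hKS x (mem_coe.1 hx)).1 (hKS y (mem_coe.1 hy)).1 hxy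
    have h1 := hX.2 (X \ (X ∩ G.nbrs Y)) (sdiff_ssubset inter_subset_left ⟨k, hk⟩)
    have h2 : G.nbrs (X \ (X ∩ G.nbrs Y)) ⊆ G.nbrs X \ (G.nbrs X ∩ Y) := by
      intro w hw
      obtain ⟨x, hx, hxw⟩ := mem_nbrs.1 hw
      simp only [mem_sdiff, mem_inter] at hx ⊢
      refine ⟨mem_nbrs.2 ⟨x, hx.1, hxw⟩, fun h => hx.2 ⟨hx.1, mem_nbrs.2 ⟨w, h.2, hxw.symm⟩⟩⟩
    have h3 := card_le_card h2
    have h4 := card_sdiff_add_card_inter X (X ∩ G.nbrs Y)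
    have h5 := card_sdiff_add_card_inter (G.nbrs X) (G.nbrs X ∩ Y)
    rw [inter_eq_right.2 inter_subset_left] at h4 h5
    have h6 := hX.1
    omega
  refine ⟨hX, hY, hA.nbrs_disjoint hXA, hA.compl.nbrs_disjoint hYA, ?_⟩
  have hNX := hA.nbrs_subset hXA
  have hNY := hA.compl.nbrs_subset hYA
  rw [compl_compl] at hNY
  simp only [disjoint_union_left, disjoint_union_right]
  refine ⟨⟨disjoint_compl_right.mono hXA hYA, ?_⟩, hXNY, (disjoint_compl_right.mono hNY hNX).symm⟩
  rw [Finset.disjoint_left]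
  intro w hw hwY
  obtain ⟨x, hx, hxw⟩ := mem_nbrs.1 hw
  exact Finset.disjoint_left.1 hXNY hx (mem_nbrs.2 ⟨w, hwY, hxw.symm⟩)

/-! ### Tight sets of excess two -/

/-- A tight subset `X` of excess one already uses two neighbours of each `b ∈ G.nbrs X`, hence all
that `b` has in `D`. So `D \ X` shares no neighbour with `X`, and it keeps excess at least `2 - 1 =
1`. -/
lemma IsColourClass.tightPair_of_card_eq_two {A D : Finset V} (hA : G.IsColourClass A)
    (hDA : D ⊆ A) (hD : G.IsTight 2 D) (hdeg : ∀ b ∈ G.nbrs D, #{x ∈ D | G.Adj b x} ≤ 2) :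
    ∃ X Y, G.TightPair X Y := by
  obtain ⟨X, hXD, hX⟩ := G.exists_isTight (k := 1) one_pos (X := D) (by have := hD.1; omega)
  have hdisj : Disjoint (G.nbrs X) (G.nbrs (D \ X)) := by
    rw [Finset.disjoint_left]
    intro b hb hb'
    obtain ⟨y, hy, hyb⟩ := mem_nbrs.1 hb'
    rw [mem_sdiff] at hy
    have h1 := hX.two_le_card hb
    have h2 := hdeg b (G.nbrs_mono hXD hb)
    have h3 : {x ∈ X | G.Adj b x} ⊂ {x ∈ D | G.Adj b x} := by
      rw [Finset.ssubset_iff_of_subset (filter_subset_filter _ hXD)]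
      exact ⟨y, mem_filter.2 ⟨hy.1, hyb.symm⟩, fun h => hy.2 (mem_filter.1 h).1⟩
    have h4 := card_lt_card h3
    omega
  obtain ⟨Y, hYD, hY⟩ := G.exists_isTight (k := 1) one_pos (X := D \ X) (by
    have h1 : G.nbrs (D \ X) ⊆ G.nbrs D \ G.nbrs X := by
      intro b hb
      exact mem_sdiff.2 ⟨G.nbrs_mono sdiff_subset hb, fun h => Finset.disjoint_left.1 hdisj h hb⟩
    have h2 := card_le_card h1
    rw [card_sdiff_of_subset (G.nbrs_mono hXD)] at h2
    rw [card_sdiff_of_subset hXD]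
    have h3 := hD.1
    have h4 := hX.1
    have h5 := card_le_card (G.nbrs_mono hXD)
    omega)
  have hXA := hXD.trans hDA
  have hYA := (hYD.trans sdiff_subset).trans hDA
  refine ⟨X, Y, hX, hY, hA.nbrs_disjoint hXA, hA.nbrs_disjoint hYA, ?_⟩
  have hNX := hA.nbrs_subset hXA
  have hNY := hA.nbrs_subset hYA
  simp only [disjoint_union_left, disjoint_union_right]
  exact ⟨⟨(disjoint_sdiff_self_left.mono_left hYD).symm,
    (disjoint_compl_right.mono hYA hNX).symm⟩,
    disjoint_compl_right.mono hXA hNY, hdisj.mono_right (G.nbrs_mono hYD)⟩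

/-- The forest bound allows at most `#D + #(G.nbrs D) - 1 = 2 * #(G.nbrs D) + 1` edges between `D`
and its neighbours. Each neighbour uses at least two, so only one edge is left to spare. -/
lemma IsTight.degree_cases (hG : G.IsTree) {D : Finset V} (hD : G.IsTight 2 D)
    (hdisj : Disjoint D (G.nbrs D)) :
    (∀ b ∈ G.nbrs D, #{x ∈ D | G.Adj b x} ≤ 2) ∨
    ∃ b₀ ∈ G.nbrs D, #{x ∈ D | G.Adj b₀ x} = 3 ∧
      ∀ b ∈ G.nbrs D, b ≠ b₀ → #{x ∈ D | G.Adj b x} = 2 := by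
  have hne : D.Nonempty := card_pos.1 (by have := hD.1; omega)
  have hE := hG.isAcyclic.sum_card_filter_adj_lt hdisj (hne.mono subset_union_left)
  have h2 := hD.1
  by_contra! hcon
  obtain ⟨⟨b₀, hb₀, hlt⟩, hcon⟩ := hcon
  have h3 := add_sum_erase (G.nbrs D) (fun b => #{x ∈ D | G.Adj b x}) hb₀
  have h4 := card_nsmul_le_sum ((G.nbrs D).erase b₀) (fun b => #{x ∈ D | G.Adj b x}) 2
    (fun b hb => hD.two_le_card (mem_erase.1 hb).2)
  rw [card_erase_of_mem hb₀, smul_eq_mul] at h4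
  have h5 : 0 < #(G.nbrs D) := card_pos.2 ⟨_, hb₀⟩
  obtain ⟨b, hb, hbne, hb2⟩ := hcon b₀ hb₀ (by omega)
  have hmem : b ∈ (G.nbrs D).erase b₀ := mem_erase.2 ⟨hbne, hb⟩
  have h6 := add_sum_erase ((G.nbrs D).erase b₀) (fun b => #{x ∈ D | G.Adj b x}) hmem
  have h7 := card_nsmul_le_sum (((G.nbrs D).erase b₀).erase b) (fun b => #{x ∈ D | G.Adj b x}) 2
    (fun b hb => hD.two_le_card (mem_erase.1 (mem_erase.1 hb).2).2)
  rw [card_erase_of_mem hmem, card_erase_of_mem hb₀, smul_eq_mul] at h7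
  have h8 := hD.two_le_card hb
  have h9 : 0 < #((G.nbrs D).erase b₀) := card_pos.2 ⟨_, hmem⟩
  rw [card_erase_of_mem hb₀] at h9
  omega


/-! ### Hubs and their three branches -/

/-- A function that is constant on each branch of a tree at the vertex `b₀`, with value the vertex
of the branch that is adjacent to `b₀`. -/
lemma IsTree.exists_branch (hG : G.IsTree) (b₀ : V) :
    ∃ br : V → V, (∀ a, G.Adj b₀ a → br a = a) ∧
      ∀ x y, G.Adj x y → x ≠ b₀ → y ≠ b₀ → br x = br y := by
  choose p hp hu using fun v => hG.existsUnique_path b₀ v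
  -- If the path from `b₀` to `y` passes through `x`, it extends the path to `x` by one edge, so
  -- both paths leave `b₀` along the same edge.
  have key : ∀ x y, G.Adj x y → x ≠ b₀ → x ∈ (p y).support → (p x).snd = (p y).snd := by
    intro x y hxy hx hsupp
    have h1 := hG.isAcyclic.path_concat (hp x) (hp y) hxy hsupp
    have hnil : ¬ (p x).Nil := fun h => hx h.eq.symm
    refine hG.isAcyclic.eq_snd_of_adj_start (hp y) (Walk.adj_snd hnil) ?_
    rw [h1]
    exact (p x).support_subset_support_concat _ ((p x).getVert_mem_support 1)
  refine ⟨fun v => (p v).snd, fun a ha => ?_, fun x y hxy hx hy => ?_⟩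
  · exact (hG.isAcyclic.eq_snd_of_adj_start (hp a) ha (p a).end_mem_support).symm
  · by_cases h : x ∈ (p y).support
    · exact key x y hxy hx h
    · exact (key y x hxy.symm hy
        (hG.isAcyclic.mem_support_of_ne_mem_support_of_adj_of_isPath (hp x) (hp y) hxy h)).symm

/-- The set `D` and its neighbourhood form a tree in which all neighbours of `D` have degree two,
except for the hub `b₀`, which has degree three; `P i` and `Q i` are the vertices in the three
branches at `b₀`. -/
structure IsHub (G : SimpleGraph V) (D : Finset V) (b₀ : V) (a : Fin 3 → V)
    (P Q : Fin 3 → Finset V) : Prop where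
  mem_branch : ∀ i, a i ∈ P i
  adj_hub : ∀ x ∈ D, G.Adj b₀ x ↔ ∃ i, x = a i
  mem_iff : ∀ x, x ∈ D ↔ ∃ i, x ∈ P i
  mem_nbrs_iff : ∀ x, x ∈ G.nbrs D ↔ x = b₀ ∨ ∃ i, x ∈ Q i
  hub_notMem : ∀ i, b₀ ∉ Q i
  disj : ∀ i j, i ≠ j → Disjoint (P i) (P j)
  disj' : ∀ i j, i ≠ j → Disjoint (Q i) (Q j)
  card_eq : ∀ i, #(P i) = #(Q i) + 1
  filter_subset : ∀ i, ∀ b ∈ Q i, {x ∈ D | G.Adj b x} ⊆ P i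
  card_filter : ∀ i, ∀ b ∈ Q i, #{x ∈ D | G.Adj b x} = 2
  disj_nbrs : Disjoint D (G.nbrs D)

/-- Away from the hub, `#D` exceeds the number of neighbours by three. In every branch all
neighbours have degree two into that branch, so the forest bound gives each of the three branches
excess at least one. Hence each excess is exactly one and nothing lies outside these branches. -/
lemma IsTight.exists_isHub (hG : G.IsTree) {D : Finset V} (hD : G.IsTight 2 D)
    (hdisj : Disjoint D (G.nbrs D)) {b₀ : V} (hb₀ : b₀ ∈ G.nbrs D)
    (h3 : #{x ∈ D | G.Adj b₀ x} = 3)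
    (h2 : ∀ b ∈ G.nbrs D, b ≠ b₀ → #{x ∈ D | G.Adj b x} = 2) :
    ∃ a P Q, G.IsHub D b₀ a P Q := by
  obtain ⟨br, hbr, hbr'⟩ := hG.exists_branch b₀
  have hb₀D : b₀ ∉ D := fun h => Finset.disjoint_left.1 hdisj h hb₀
  let e := (finCongr (by rw [Fintype.card_coe, h3] :
    3 = Fintype.card ({x ∈ D | G.Adj b₀ x} : Finset V))).trans (Fintype.equivFin _).symm
  let a : Fin 3 → V := fun i => e i
  have ha : ∀ i, a i ∈ D ∧ G.Adj b₀ (a i) := fun i => mem_filter.1 (e i).2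
  have hainj : Function.Injective a := Subtype.val_injective.comp e.injective
  have hadj : ∀ x ∈ D, G.Adj b₀ x ↔ ∃ i, x = a i := fun x hx => by
    constructor
    · intro h
      exact ⟨e.symm ⟨x, mem_filter.2 ⟨hx, h⟩⟩, by simp [a]⟩
    · rintro ⟨i, rfl⟩
      exact (ha i).2
  -- The predicate `p` selects branches by their label. Edges at `b ≠ b₀` stay inside a branch, so
  -- the forest bound applies to any nonempty union of branches.
  have hbound : ∀ p : V → Prop, (∃ v ∈ D ∪ (G.nbrs D).erase b₀, p (br v)) →
      2 * #{b ∈ (G.nbrs D).erase b₀ | p (br b)} + 1 ≤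
        #{x ∈ D | p (br x)} + #{b ∈ (G.nbrs D).erase b₀ | p (br b)} := by
    rintro p ⟨v, hv, hpv⟩
    refine hG.isAcyclic.mul_card_lt ?_ ⟨v, ?_⟩ ?_
    · exact (hdisj.mono_right (erase_subset _ _)).mono (filter_subset _ _) (filter_subset _ _)
    · rw [mem_union] at hv
      simp only [mem_union, mem_filter]
      tauto
    · intro b hb
      rw [mem_filter, mem_erase] at hb
      rw [← h2 b hb.1.2 hb.1.1]
      refine card_le_card fun x hx => ?_
      rw [mem_filter] at hx
      refine mem_filter.2 ⟨mem_filter.2 ⟨hx.1, ?_⟩, hx.2⟩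
      rw [← hbr' b x hx.2 hb.1.1 (fun h => hb₀D (h ▸ hx.1))]
      exact hb.2
  set P : Fin 3 → Finset V := fun i => {x ∈ D | br x = a i} with hP
  set Q : Fin 3 → Finset V := fun i => {b ∈ (G.nbrs D).erase b₀ | br b = a i} with hQ
  have haP : ∀ i, a i ∈ P i := fun i => mem_filter.2 ⟨(ha i).1, hbr _ (ha i).2⟩
  have hPQ : ∀ i, #(Q i) + 1 ≤ #(P i) := fun i => by
    have := hbound (fun v => v = a i) ⟨a i, mem_union_left _ (ha i).1, hbr _ (ha i).2⟩
    simp only [hP, hQ]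
    omega
  have hPdisj : ∀ i j, i ≠ j → Disjoint (P i) (P j) := fun i j hij => by
    rw [Finset.disjoint_left]
    intro x hx hx'
    exact hij (hainj ((mem_filter.1 hx).2.symm.trans (mem_filter.1 hx').2))
  have hQdisj : ∀ i j, i ≠ j → Disjoint (Q i) (Q j) := fun i j hij => by
    rw [Finset.disjoint_left]
    intro x hx hx'
    exact hij (hainj ((mem_filter.1 hx).2.symm.trans (mem_filter.1 hx').2))
  -- `R` selects all branches other than the three at the `a i`. If nonempty, their union would also
  -- have positive excess, one too many.
  obtain ⟨R, hR⟩ : ∃ R : V → Prop, ∀ v, R v ↔ ∀ i, v ≠ a i := ⟨_, fun _ => Iff.rfl⟩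
  have hsum : ∀ X : Finset V, #X = (∑ i, #{x ∈ X | br x = a i}) + #{x ∈ X | R (br x)} := by
    intro X
    have h1 : univ.biUnion (fun i => {x ∈ X | br x = a i}) = {x ∈ X | ¬ R (br x)} := by
      ext x; simp [hR]
    rw [← card_biUnion (fun i _ j _ hij => by
      rw [Function.onFun, Finset.disjoint_left]
      intro x hx hx'
      exact hij (hainj ((mem_filter.1 hx).2.symm.trans (mem_filter.1 hx').2))), h1]
    have := card_filter_add_card_filter_not (s := X) (fun x => R (br x))
    omega
  have hD0 : #D = (∑ i, #(P i)) + #{x ∈ D | R (br x)} := hsum D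
  have hN0 : #((G.nbrs D).erase b₀) =
    (∑ i, #(Q i)) + #{x ∈ (G.nbrs D).erase b₀ | R (br x)} := hsum ((G.nbrs D).erase b₀)
  rw [card_erase_of_mem hb₀] at hN0
  have hNpos : 0 < #(G.nbrs D) := card_pos.2 ⟨_, hb₀⟩
  have hDcard := hD.1
  have hF : ∑ i, #(P i) = #(P 0) + #(P 1) + #(P 2) := Fin.sum_univ_three _
  have hF' : ∑ i, #(Q i) = #(Q 0) + #(Q 1) + #(Q 2) := Fin.sum_univ_three _
  have h0 := hPQ 0
  have h1 := hPQ 1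
  have h2' := hPQ 2
  have hall : ∀ v ∈ D ∪ (G.nbrs D).erase b₀, ∃ i, br v = a i := by
    intro v hv
    by_contra! hcon
    have := hbound R ⟨v, hv, (hR _).2 hcon⟩
    omega
  have hD00 : #{x ∈ D | R (br x)} = 0 := by
    rw [card_eq_zero, filter_eq_empty_iff]
    intro x hx h
    obtain ⟨i, hi⟩ := hall x (mem_union_left _ hx)
    exact (hR _).1 h i hi
  have hN00 : #{x ∈ (G.nbrs D).erase b₀ | R (br x)} = 0 := by
    rw [card_eq_zero, filter_eq_empty_iff]
    intro x hx h
    obtain ⟨i, hi⟩ := hall x (mem_union_right _ hx)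
    exact (hR _).1 h i hi
  have hcard : ∀ i, #(P i) = #(Q i) + 1 := by
    rw [Fin.forall_fin_succ, Fin.forall_fin_two]
    refine ⟨?_, ?_, ?_⟩
    · omega
    · show #(P 1) = #(Q 1) + 1
      omega
    · show #(P 2) = #(Q 2) + 1
      omega
  refine ⟨a, P, Q, haP, hadj, ?_, ?_, ?_, hPdisj, hQdisj, hcard, ?_, ?_, hdisj⟩
  · intro x
    constructor
    · intro hx
      obtain ⟨i, hi⟩ := hall x (mem_union_left _ hx)
      exact ⟨i, mem_filter.2 ⟨hx, hi⟩⟩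
    · rintro ⟨i, hi⟩
      exact (mem_filter.1 hi).1
  · intro x
    constructor
    · intro hx
      by_cases hxb : x = b₀
      · exact .inl hxb
      · have hx' := mem_erase.2 ⟨hxb, hx⟩
        obtain ⟨i, hi⟩ := hall x (mem_union_right _ hx')
        exact .inr ⟨i, mem_filter.2 ⟨hx', hi⟩⟩
    · rintro (rfl | ⟨i, hi⟩)
      · exact hb₀
      · exact (mem_erase.1 (mem_filter.1 hi).1).2
  · intro i h
    exact (mem_erase.1 (mem_filter.1 h).1).1 rfl
  · intro i b hb x hx
    rw [mem_filter] at hx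
    have hb' := mem_filter.1 hb
    refine mem_filter.2 ⟨hx.1, ?_⟩
    rw [← hbr' b x hx.2 (mem_erase.1 hb'.1).1 (fun h => hb₀D (h ▸ hx.1))]
    exact hb'.2
  · intro i b hb
    have hb' := mem_erase.1 (mem_filter.1 hb).1
    exact h2 b hb'.2 hb'.1

namespace IsHub

variable {D : Finset V} {b₀ : V} {a : Fin 3 → V} {P Q : Fin 3 → Finset V}

lemma subset (h : G.IsHub D b₀ a P Q) (i : Fin 3) : P i ⊆ D := fun x hx => (h.mem_iff x).2 ⟨i, hx⟩

lemma adj_branch (h : G.IsHub D b₀ a P Q) (i : Fin 3) : G.Adj b₀ (a i) :=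
  (h.adj_hub _ (h.subset i (h.mem_branch i))).2 ⟨i, rfl⟩

lemma disj_branch (h : G.IsHub D b₀ a P Q) (i : Fin 3) : Disjoint (P i) (Q i) :=
  h.disj_nbrs.mono (h.subset i) fun x hx => (h.mem_nbrs_iff x).2 (.inr ⟨i, hx⟩)

/-- Two branches together have `#(Q i) + #(Q j) + 2` vertices in `D`, but only one more neighbour
than `#(Q i) + #(Q j)`, because they share the hub. -/
lemma exists_mem_of_ne (h : G.IsHub D b₀ a P Q) {S : Finset V} {m : V → V}
    (hm : G.CoversOff S m) {i j : Fin 3} (hij : i ≠ j) : ∃ x ∈ P i ∪ P j, x ∈ S := by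
  refine hm.exists_mem_of_card_lt ?_
  have hsub : G.nbrs (P i ∪ P j) ⊆ insert b₀ (Q i ∪ Q j) := by
    intro b hb
    obtain ⟨x, hx, hxb⟩ := mem_nbrs.1 hb
    have hxD : x ∈ D := by
      rw [mem_union] at hx
      rcases hx with hx | hx
      exacts [h.subset i hx, h.subset j hx]
    rcases (h.mem_nbrs_iff b).1 (mem_nbrs.2 ⟨x, hxD, hxb⟩) with rfl | ⟨k, hk⟩
    · simp
    · have hxk := h.filter_subset k b hk (mem_filter.2 ⟨hxD, hxb.symm⟩)
      rw [mem_union] at hx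
      rw [mem_insert, mem_union]
      rcases hx with hx | hx
      · by_cases hki : k = i
        · subst hki; exact .inr (.inl hk)
        · exact absurd hx (Finset.disjoint_left.1 (h.disj k i hki) hxk)
      · by_cases hki : k = j
        · subst hki; exact .inr (.inr hk)
        · exact absurd hx (Finset.disjoint_left.1 (h.disj k j hki) hxk)
  have h1 := card_le_card hsub
  have h2 := card_insert_le b₀ (Q i ∪ Q j)
  have h3 := card_union_le (Q i) (Q j)
  have h4 := h.card_eq i
  have h5 := h.card_eq j
  rw [card_union_of_disjoint (h.disj i j hij)]
  omega

lemma exists_pair (h : G.IsHub D b₀ a P Q) {S : Finset V} (hS : S ∈ G.avoidableSets 2) :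
    ∃ i j, i < j ∧ S ∈ crossPairs (G.leavesIn (P i)) (G.leavesIn (P j)) := by
  obtain ⟨hcard, hleaf, m, hm⟩ := mem_avoidableSets.1 hS
  have key : ∀ i j x y, x ∈ P i → y ∈ P j → x ∈ S → y ∈ S → i < j →
      ∃ i j, i < j ∧ S ∈ crossPairs (G.leavesIn (P i)) (G.leavesIn (P j)) := by
    intro i j x y hx hy hxS hyS hij
    refine ⟨i, j, hij, mem_crossPairs.2 ⟨x, mem_leavesIn.2 ⟨hx, hleaf x hxS⟩, y,
      mem_leavesIn.2 ⟨hy, hleaf y hyS⟩, eq_pair_of_card_two hcard hxS hyS ?_⟩⟩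
    rintro rfl
    exact Finset.disjoint_left.1 (h.disj i j hij.ne) hx hy
  by_cases h0 : ∃ x ∈ P 0, x ∈ S
  · obtain ⟨x, hx, hxS⟩ := h0
    obtain ⟨y, hy, hyS⟩ := h.exists_mem_of_ne hm (i := 1) (j := 2) (by decide)
    rw [mem_union] at hy
    rcases hy with hy | hy
    · exact key 0 1 x y hx hy hxS hyS (by decide)
    · exact key 0 2 x y hx hy hxS hyS (by decide)
  · push Not at h0
    obtain ⟨x, hx, hxS⟩ := h.exists_mem_of_ne hm (i := 0) (j := 1) (by decide)
    obtain ⟨y, hy, hyS⟩ := h.exists_mem_of_ne hm (i := 0) (j := 2) (by decide)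
    rw [mem_union] at hx hy
    have hx' : x ∈ P 1 := hx.resolve_left fun h => h0 x h hxS
    have hy' : y ∈ P 2 := hy.resolve_left fun h => h0 y h hyS
    exact key 1 2 x y hx' hy' hxS hyS (by decide)

lemma card_avoidableSets_le (h : G.IsHub D b₀ a P Q) :
    #(G.avoidableSets 2) ≤ #(G.leavesIn (P 0)) * #(G.leavesIn (P 1)) +
      #(G.leavesIn (P 0)) * #(G.leavesIn (P 2)) + #(G.leavesIn (P 1)) * #(G.leavesIn (P 2)) := by
  have hsub : G.avoidableSets 2 ⊆ (crossPairs (G.leavesIn (P 0)) (G.leavesIn (P 1)) ∪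
      crossPairs (G.leavesIn (P 0)) (G.leavesIn (P 2))) ∪
      crossPairs (G.leavesIn (P 1)) (G.leavesIn (P 2)) := by
    intro S hS
    obtain ⟨i, j, hij, h⟩ := h.exists_pair hS
    rw [mem_union, mem_union]
    fin_cases i <;> fin_cases j <;> simp at hij h <;> tauto
  refine (card_le_card hsub).trans ((card_union_le _ _).trans (add_le_add ?_ ?_))
  · exact (card_union_le _ _).trans (add_le_add (card_crossPairs_le _ _) (card_crossPairs_le _ _))
  · exact card_crossPairs_le _ _

/-- Were `a i` a leaf, the hub would be its only neighbour, so each `b ∈ Q i` would have both its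
neighbours in `(P i).erase (a i)`. That set has only `#(Q i)` vertices, against the forest bound. A
branch with `P i = {a i}` is the exception, whence the `max` with 1 below. -/
lemma leavesIn_subset_erase (hG : G.IsTree) (h : G.IsHub D b₀ a P Q) {i : Fin 3}
    (hi : 2 ≤ #(P i)) : G.leavesIn (P i) ⊆ (P i).erase (a i) := by
  intro x hx
  rw [mem_leavesIn] at hx
  refine mem_erase.2 ⟨?_, hx.1⟩
  rintro rfl
  have hdisj : Disjoint ((P i).erase (a i)) (Q i) := (h.disj_branch i).mono_left (erase_subset _ _)
  have h1 := h.card_eq i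
  have h2 := card_erase_of_mem hx.1
  have := hG.isAcyclic.mul_card_lt (k := 2) hdisj ⟨_, mem_union_left _ (card_pos.1
    (by omega : 0 < #((P i).erase (a i)))).choose_spec⟩ (fun b hb => by
    rw [← h.card_filter i b hb]
    refine card_le_card fun y hy => mem_filter.2 ⟨mem_erase.2 ⟨?_, h.filter_subset i b hb hy⟩,
      (mem_filter.1 hy).2⟩
    rintro rfl
    have := hx.2.eq_of_adj (h.adj_branch i).symm (mem_filter.1 hy).2.symm
    exact h.hub_notMem i (this ▸ hb))
  omega

lemma card_leavesIn_le (hG : G.IsTree) (h : G.IsHub D b₀ a P Q) (i : Fin 3) :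
    #(G.leavesIn (P i)) ≤ max (#(P i) - 1) 1 := by
  by_cases hi : 2 ≤ #(P i)
  · have h1 := card_le_card (h.leavesIn_subset_erase hG hi)
    rw [card_erase_of_mem (h.mem_branch i)] at h1
    omega
  · have := card_le_card (leavesIn_subset (G := G) (X := P i))
    omega

lemma card_eq_sum (h : G.IsHub D b₀ a P Q) : #D = #(P 0) + #(P 1) + #(P 2) := by
  have h1 : D = (P 0 ∪ P 1) ∪ P 2 := by
    ext x
    rw [h.mem_iff, Fin.exists_fin_succ, Fin.exists_fin_two, mem_union, mem_union, or_assoc]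
    rfl
  rw [h1, card_union_of_disjoint, card_union_of_disjoint (h.disj 0 1 (by decide))]
  rw [disjoint_union_left]
  exact ⟨h.disj 0 2 (by decide), h.disj 1 2 (by decide)⟩

/-- With the maximal number of leaves, everything in `P i` but `a i` is a leaf. The neighbour of
each such leaf is also adjacent to `a i`, so the branch is a spider centred at `a i`. -/
lemma exists_legs (hG : G.IsTree) (h : G.IsHub D b₀ a P Q)
    {i : Fin 3} (hi : #(G.leavesIn (P i)) = max (#(P i) - 1) 1) :
    ∃ β e : Fin (#(P i) - 1) → V, (∀ j, G.Adj (a i) (β j)) ∧ (∀ j, G.Adj (β j) (e j)) ∧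
      ∀ v, v ∈ P i ∨ v ∈ Q i → v = a i ∨ ∃ j, v = β j ∨ v = e j := by
  have hleaf : ∀ d ∈ (P i).erase (a i), G.IsLeafVertex d := by
    intro d hd
    have h1 : 0 < #((P i).erase (a i)) := card_pos.2 ⟨d, hd⟩
    rw [card_erase_of_mem (h.mem_branch i)] at h1
    have h2 := eq_of_subset_of_card_le (h.leavesIn_subset_erase hG (i := i) (by omega))
      (by rw [card_erase_of_mem (h.mem_branch i)]; omega)
    rw [← h2] at hd
    exact (mem_leavesIn.1 hd).2
  have hβ : ∀ d, ∃ w, d ∈ (P i).erase (a i) → w ∈ Q i ∧ G.Adj d w ∧ G.Adj (a i) w := by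
    intro d
    by_cases hd : d ∈ (P i).erase (a i)
    swap
    · exact ⟨d, fun h => absurd h hd⟩
    obtain ⟨w, hw⟩ := (hleaf d hd).exists_adj_iff
    have hdw := (hw w).2 rfl
    obtain ⟨hda, hdP⟩ := mem_erase.1 hd
    have hdD := h.subset i hdP
    have hwQ : w ∈ Q i := by
      rcases (h.mem_nbrs_iff w).1 (mem_nbrs.2 ⟨d, hdD, hdw⟩) with rfl | ⟨k, hk⟩
      · obtain ⟨k, rfl⟩ := (h.adj_hub d hdD).1 hdw.symm
        by_cases hki : k = i
        · exact absurd (congrArg a hki) hda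
        · exact absurd hdP (Finset.disjoint_left.1 (h.disj k i hki) (h.mem_branch k))
      · have hdk := h.filter_subset k w hk (mem_filter.2 ⟨hdD, hdw.symm⟩)
        by_cases hki : k = i
        · exact hki ▸ hk
        · exact absurd hdP (Finset.disjoint_left.1 (h.disj k i hki) hdk)
    refine ⟨w, fun _ => ⟨hwQ, hdw, ?_⟩⟩
    -- Otherwise both neighbours of `w` in `D` are leaves. Removing `w` and these leaves keeps the
    -- other degrees equal to two, but leaves equally many vertices on both sides, which the forest
    -- bound forbids.
    by_contra hna
    have hnb : ∀ x ∈ {x ∈ D | G.Adj w x}, x ∈ (P i).erase (a i) := by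
      intro x hx
      refine mem_erase.2 ⟨?_, h.filter_subset i w hwQ hx⟩
      rintro rfl
      exact hna (mem_filter.1 hx).2.symm
    have hsub : {x ∈ D | G.Adj w x} ⊆ P i := h.filter_subset i w hwQ
    have h1 := h.card_eq i
    have h2 := card_sdiff_of_subset hsub
    have h3 := card_erase_of_mem hwQ
    have h4 := h.card_filter i w hwQ
    have hdisj : Disjoint (P i \ {x ∈ D | G.Adj w x}) ((Q i).erase w) :=
      (h.disj_branch i).mono sdiff_subset (erase_subset _ _)
    have h5 := hG.isAcyclic.mul_card_lt (k := 2) hdisj ⟨a i, mem_union_left _ (mem_sdiff.2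
      ⟨h.mem_branch i, fun hx => (mem_erase.1 (hnb _ hx)).1 rfl⟩)⟩ (fun b hb => by
      rw [mem_erase] at hb
      rw [← h.card_filter i b hb.2]
      refine card_le_card fun y hy => mem_filter.2 ⟨mem_sdiff.2 ⟨h.filter_subset i b hb.2 hy,
        fun hy' => hb.1 ?_⟩, (mem_filter.1 hy).2⟩
      exact (hleaf y (hnb y hy')).eq_of_adj (mem_filter.1 hy).2.symm (mem_filter.1 hy').2.symm)
    have h6 : 0 < #(Q i) := card_pos.2 ⟨w, hwQ⟩
    have h7 := card_le_card hsub
    omega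
  choose β hβ using hβ
  let e : Fin (#(P i) - 1) ≃ ((P i).erase (a i) : Finset V) :=
    (finCongr (by rw [Fintype.card_coe, card_erase_of_mem (h.mem_branch i)])).trans
      (Fintype.equivFin _).symm
  refine ⟨fun j => β (e j), fun j => e j, fun j => (hβ _ (e j).2).2.2,
    fun j => (hβ _ (e j).2).2.1.symm, ?_⟩
  rintro v (hv | hv)
  · by_cases hva : v = a i
    · exact .inl hva
    · exact .inr ⟨e.symm ⟨v, mem_erase.2 ⟨hva, hv⟩⟩, .inr (by simp)⟩
  · right
    obtain ⟨d, hd, hda⟩ := exists_mem_ne (by rw [h.card_filter i v hv]; decide :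
      1 < #{x ∈ D | G.Adj v x}) (a i)
    have hd' := mem_erase.2 ⟨hda, h.filter_subset i v hv hd⟩
    refine ⟨e.symm ⟨d, hd'⟩, .inl ?_⟩
    simp only [Equiv.apply_symm_apply]
    exact (hleaf d hd').eq_of_adj (mem_filter.1 hd).2.symm (hβ d hd').2.1

lemma nonempty_iso_spiderTrio (hG : G.IsTree) (h : G.IsHub D b₀ a P Q)
    (hcov : D ∪ G.nbrs D = univ)
    (hcard : 2 * ((#(P 0) - 1) + (#(P 1) - 1) + (#(P 2) - 1)) + 4 = Fintype.card V)
    (hi : ∀ i, #(G.leavesIn (P i)) = max (#(P i) - 1) 1) :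
    Nonempty (G ≃g spiderTrio (#(P 0) - 1) (#(P 1) - 1) (#(P 2) - 1)) := by
  obtain ⟨β₀, e₀, h1, h2, h3⟩ := h.exists_legs hG (hi 0)
  obtain ⟨β₁, e₁, k1, k2, k3⟩ := h.exists_legs hG (hi 1)
  obtain ⟨β₂, e₂, l1, l2, l3⟩ := h.exists_legs hG (hi 2)
  refine hG.nonempty_iso_of_surjective (spiderTrio_isTree _ _ _).connected
    (fun | none => b₀
         | some (.inl none) => a 0
         | some (.inl (some (j, false))) => β₀ j
         | some (.inl (some (j, true))) => e₀ j
         | some (.inr (.inl none)) => a 1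
         | some (.inr (.inl (some (j, false)))) => β₁ j
         | some (.inr (.inl (some (j, true)))) => e₁ j
         | some (.inr (.inr none)) => a 2
         | some (.inr (.inr (some (j, false)))) => β₂ j
         | some (.inr (.inr (some (j, true)))) => e₂ j) ?_ ?_ (by rw [card_spiderTrio, hcard])
  · rintro (_ | (x | (x | x))) (_ | (y | (y | y))) hadj <;>
      simp only [spiderTrio, addVertex, Set.mem_insert_iff, Set.mem_singleton_iff, Sum.inl.injEq,
        Sum.inr.injEq, reduceCtorEq, or_false, false_or, sum_adj] at hadj
    · subst hadj; exact h.adj_branch 0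
    · subst hadj; exact h.adj_branch 1
    · subst hadj; exact h.adj_branch 2
    · subst hadj; exact (h.adj_branch 0).symm
    · rcases x with _ | ⟨i, _ | _⟩ <;> rcases y with _ | ⟨j, _ | _⟩ <;> simp [spider] at hadj ⊢
      · exact h1 j
      · exact (h1 i).symm
      · subst hadj; exact h2 i
      · subst hadj; exact (h2 j).symm
    · subst hadj; exact (h.adj_branch 1).symm
    · rcases x with _ | ⟨i, _ | _⟩ <;> rcases y with _ | ⟨j, _ | _⟩ <;> simp [spider] at hadj ⊢
      · exact k1 j
      · exact (k1 i).symm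
      · subst hadj; exact k2 i
      · subst hadj; exact (k2 j).symm
    · subst hadj; exact (h.adj_branch 2).symm
    · rcases x with _ | ⟨i, _ | _⟩ <;> rcases y with _ | ⟨j, _ | _⟩ <;> simp [spider] at hadj ⊢
      · exact l1 j
      · exact (l1 i).symm
      · subst hadj; exact l2 i
      · subst hadj; exact (l2 j).symm
  · intro v
    have hv := mem_univ v
    rw [← hcov, mem_union, h.mem_iff, h.mem_nbrs_iff] at hv
    have hv' : v = b₀ ∨ ∃ i, v ∈ P i ∨ v ∈ Q i := by
      rcases hv with ⟨i, hi⟩ | hv | ⟨i, hi⟩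
      exacts [.inr ⟨i, .inl hi⟩, .inl hv, .inr ⟨i, .inr hi⟩]
    rcases hv' with rfl | ⟨i, hi⟩
    · exact ⟨none, rfl⟩
    · fin_cases i
      · rcases h3 v hi with rfl | ⟨j, rfl | rfl⟩
        exacts [⟨some (.inl none), rfl⟩, ⟨some (.inl (some (j, false))), rfl⟩,
          ⟨some (.inl (some (j, true))), rfl⟩]
      · rcases k3 v hi with rfl | ⟨j, rfl | rfl⟩
        exacts [⟨some (.inr (.inl none)), rfl⟩, ⟨some (.inr (.inl (some (j, false)))), rfl⟩,
          ⟨some (.inr (.inl (some (j, true)))), rfl⟩]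
      · rcases l3 v hi with rfl | ⟨j, rfl | rfl⟩
        exacts [⟨some (.inr (.inr none)), rfl⟩, ⟨some (.inr (.inr (some (j, false)))), rfl⟩,
          ⟨some (.inr (.inr (some (j, true)))), rfl⟩]

end IsHub

/-! ### Comparison with spider-trios -/

/-- The number of strong almost-perfect matchings of a spider-trio. -/
def trioCount (a b c : ℕ) : ℕ :=
  max a 1 * max b 1 + max a 1 * max c 1 + max b 1 * max c 1

/-- At `X, Y, Z` the sum is strictly monotone in each variable as soon as the other two do not both
vanish; positivity of `X` and `Y` suffices for that. -/
lemma eq_of_trioSum_le {x y z X Y Z : ℕ} (hx : x ≤ X) (hy : y ≤ Y) (hz : z ≤ Z) (hX : 1 ≤ X)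
    (hY : 1 ≤ Y) (h : X * Y + X * Z + Y * Z ≤ x * y + x * z + y * z) :
    x = X ∧ y = Y ∧ z = Z := by
  have h1 : x * y ≤ x * Y := Nat.mul_le_mul_left _ hy
  have h2 : x * z ≤ x * Z := Nat.mul_le_mul_left _ hz
  have h3 : y * z ≤ Y * Z := Nat.mul_le_mul hy hz
  have h4 : x * y ≤ X * y := Nat.mul_le_mul_right _ hx
  have h5 : y * z ≤ y * Z := Nat.mul_le_mul_left _ hz
  have h6 : x * z ≤ X * Z := Nat.mul_le_mul hx hz
  have h7 : x * z ≤ X * z := Nat.mul_le_mul_right _ hx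
  have h8 : y * z ≤ Y * z := Nat.mul_le_mul_right _ hy
  have h9 : x * y ≤ X * Y := Nat.mul_le_mul hx hy
  refine ⟨le_antisymm hx ?_, le_antisymm hy ?_, le_antisymm hz ?_⟩ <;> nlinarith

lemma IsHub.exists_bound (hG : G.IsTree) {D : Finset V} {b₀ : V} {a : Fin 3 → V}
    {P Q : Fin 3 → Finset V} (hD : G.IsTight 2 D) (h : G.IsHub D b₀ a P Q) :
    ∃ a b c, 2 * (a + b + c) + 4 ≤ Fintype.card V ∧ #(G.avoidableSets 2) ≤ trioCount a b c ∧
      (2 * (a + b + c) + 4 = Fintype.card V → trioCount a b c ≤ #(G.avoidableSets 2) →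
        Nonempty (G ≃g spiderTrio a b c)) := by
  have h0 := h.card_eq 0
  have h1 := h.card_eq 1
  have h2 := h.card_eq 2
  have hc := h.card_eq_sum
  have hD1 := hD.1
  have hu := card_le_univ (D ∪ G.nbrs D)
  have hu' := card_union_of_disjoint h.disj_nbrs
  have hle := h.card_avoidableSets_le
  have hl := h.card_leavesIn_le hG
  -- Here `2 * (a + b + c) + 4 = 2 * #D - 2 = #D + #(G.nbrs D)`, so equality with the order means
  -- that `D` and its neighbours are the whole tree.
  refine ⟨#(P 0) - 1, #(P 1) - 1, #(P 2) - 1, by omega, ?_, fun hV hge => ?_⟩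
  · refine hle.trans ?_
    unfold trioCount
    gcongr <;> exact hl _
  · have heq := eq_of_trioSum_le (hl 0) (hl 1) (hl 2) (le_max_right _ _)
      (le_max_right _ _) (hge.trans hle)
    refine h.nonempty_iso_spiderTrio hG (eq_univ_of_card _ (by omega)) hV ?_
    intro i
    fin_cases i
    exacts [heq.1, heq.2.1, heq.2.2]


lemma spiderTrio_swap_left (a b c : ℕ) : Nonempty (spiderTrio a b c ≃g spiderTrio b a c) := by
  refine (spiderTrio_isTree a b c).nonempty_iso_of_surjective (spiderTrio_isTree b a c).connected
    (fun | none => none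
         | some (.inl x) => some (.inr (.inl x))
         | some (.inr (.inl x)) => some (.inl x)
         | some (.inr (.inr x)) => some (.inr (.inr x))) ?_ ?_ ?_
  · rintro (_ | (x | (x | x))) (_ | (y | (y | y))) h <;>
      simp [spiderTrio, addVertex] at h ⊢ <;> exact h
  · rintro (_ | (x | (x | x)))
    exacts [⟨none, rfl⟩, ⟨some (.inr (.inl x)), rfl⟩, ⟨some (.inl x), rfl⟩,
      ⟨some (.inr (.inr x)), rfl⟩]
  · rw [card_spiderTrio, card_spiderTrio]
    omega

lemma spiderTrio_swap_right (a b c : ℕ) : Nonempty (spiderTrio a b c ≃g spiderTrio a c b) := by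
  refine (spiderTrio_isTree a b c).nonempty_iso_of_surjective (spiderTrio_isTree a c b).connected
    (fun | none => none
         | some (.inl x) => some (.inl x)
         | some (.inr (.inl x)) => some (.inr (.inr x))
         | some (.inr (.inr x)) => some (.inr (.inl x))) ?_ ?_ ?_
  · rintro (_ | (x | (x | x))) (_ | (y | (y | y))) h <;>
      simp [spiderTrio, addVertex] at h ⊢ <;> exact h
  · rintro (_ | (x | (x | x)))
    exacts [⟨none, rfl⟩, ⟨some (.inl x), rfl⟩, ⟨some (.inr (.inr x)), rfl⟩,
      ⟨some (.inr (.inl x)), rfl⟩]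
  · rw [card_spiderTrio, card_spiderTrio]
    omega

/-- The bound on the number of avoidable pairs given by three branches with `a ≥ b ≥ c` legs. -/
def TrioBound (G : SimpleGraph V) (a b c : ℕ) : Prop :=
  2 * (a + b + c) + 4 ≤ Fintype.card V ∧ #(G.avoidableSets 2) ≤ trioCount a b c ∧
    (2 * (a + b + c) + 4 = Fintype.card V → trioCount a b c ≤ #(G.avoidableSets 2) →
      Nonempty (G ≃g spiderTrio a b c))

lemma TrioBound.swap_left {a b c : ℕ} (h : G.TrioBound a b c) : G.TrioBound b a c := by
  obtain ⟨h1, h2, h3⟩ := h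
  have h4 : trioCount b a c = trioCount a b c := by unfold trioCount; ring
  refine ⟨by omega, by omega, fun h5 h6 => ?_⟩
  obtain ⟨e⟩ := h3 (by omega) (by omega)
  obtain ⟨e'⟩ := spiderTrio_swap_left a b c
  exact ⟨e.trans e'⟩

lemma TrioBound.swap_right {a b c : ℕ} (h : G.TrioBound a b c) : G.TrioBound a c b := by
  obtain ⟨h1, h2, h3⟩ := h
  have h4 : trioCount a c b = trioCount a b c := by unfold trioCount; ring
  refine ⟨by omega, by omega, fun h5 h6 => ?_⟩
  obtain ⟨e⟩ := h3 (by omega) (by omega)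
  obtain ⟨e'⟩ := spiderTrio_swap_right a b c
  exact ⟨e.trans e'⟩

lemma TrioBound.exists_sorted {a b c : ℕ} (h : G.TrioBound a b c) :
    ∃ a b c, b ≤ a ∧ c ≤ b ∧ G.TrioBound a b c := by
  rcases le_total a b with hab | hab <;> rcases le_total b c with hbc | hbc <;>
    rcases le_total a c with hac | hac
  · exact ⟨c, b, a, hbc, hab, h.swap_left.swap_right.swap_left⟩
  · exact ⟨c, b, a, hbc, hab, h.swap_left.swap_right.swap_left⟩
  · exact ⟨b, c, a, hbc, hac, h.swap_left.swap_right⟩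
  · exact ⟨b, a, c, hab, hac, h.swap_left⟩
  · exact ⟨c, a, b, hac, hab, h.swap_right.swap_left⟩
  · exact ⟨a, c, b, hac, hbc, h.swap_right⟩
  · exact ⟨a, b, c, hab, hbc, h⟩
  · exact ⟨a, b, c, hab, hbc, h⟩

/-! ### Assembling the structural bounds -/

/-- The structural bounds on the number of avoidable pairs in a tree of even order. -/
inductive PairBound (G : SimpleGraph V) (s : ℕ) : Prop
  | trio (a b c : ℕ) (hab : b ≤ a) (hbc : c ≤ b) (h : G.TrioBound a b c)
  | tight (p q : ℕ) (hp : 0 < p) (hq : 0 < q) (hpq : p + q ≤ s + 1)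
      (hle : #(G.avoidableSets 2) ≤ max p 2 * max q 2)
      (hiso : s = 1 → 4 ≤ #(G.avoidableSets 2) → Nonempty (G ≃g doubleBroom 2 2))
  | linear (h : #(G.avoidableSets 2) ≤ s + 1)
  | product (x y : ℕ) (hxy : x + y ≤ s + 1) (h : #(G.avoidableSets 2) ≤ x * y)

lemma TightPair.pairBound (hG : G.IsTree) {s : ℕ} (hV : Fintype.card V = 2 * s + 4)
    {X Y : Finset V} (h : G.TightPair X Y) : G.PairBound s := by
  have : Nontrivial V := Fintype.one_lt_card_iff_nontrivial.1 (by omega)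
  obtain ⟨p, q, hp, hq, h1, h2, h3⟩ := h.exists_bound hG
  exact .tight p q hp hq (by omega) h2 fun hs => h3 (by omega)

lemma IsColourClass.pairBound_of_card_eq_add_two (hG : G.IsTree) {s : ℕ}
    (hV : Fintype.card V = 2 * s + 4) {A : Finset V} (hA : G.IsColourClass A)
    (hcard : #A = #Aᶜ + 2) : G.PairBound s := by
  obtain ⟨D, hDA, hD⟩ := G.exists_isTight (k := 2) two_pos (X := A) (by
    have := card_le_card (hA.nbrs_subset (Subset.refl A))
    omega)
  have hdisj := hA.nbrs_disjoint hDA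
  rcases hD.degree_cases hG hdisj with h | ⟨b₀, hb₀, h3, h2⟩
  · obtain ⟨X, Y, hXY⟩ := hA.tightPair_of_card_eq_two hDA hD h
    exact hXY.pairBound hG hV
  · obtain ⟨a, P, Q, h⟩ := hD.exists_isHub hG hdisj hb₀ h3 h2
    obtain ⟨a, b, c, h⟩ := h.exists_bound hG hD
    obtain ⟨a, b, c, hab, hbc, h⟩ := TrioBound.exists_sorted (a := a) (b := b) (c := c) h
    exact .trio a b c hab hbc h

/-- Because the classes have equal size, the absence of a perfect matching gives a Hall violator in
each of them, not just in one. -/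
lemma IsColourClass.pairBound_of_card_eq (hG : G.IsTree) {s : ℕ}
    (hV : Fintype.card V = 2 * s + 4) {A : Finset V} (hA : G.IsColourClass A)
    (hcard : #A = #Aᶜ) {S : Finset V} (hS : S ∈ G.avoidableSets 2) : G.PairBound s := by
  by_cases hm : ∃ m, G.CoversOff ∅ m
  · obtain ⟨m, hm⟩ := hm
    rcases hm.card_avoidableSets_le hG hA hcard hV with h | ⟨x, y, hxy, h⟩
    exacts [.linear h, .product x y hxy h]
  · have hex : ∀ B : Finset V, G.IsColourClass B → #B = #Bᶜ → ∃ X ⊆ B, G.IsTight 1 X := by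
      intro B hB hBc
      by_contra! hcon
      refine hm (hB.exists_coversOff_empty hBc fun X hX => ?_)
      by_contra! hlt
      obtain ⟨D, hDX, hD⟩ := G.exists_isTight one_pos (X := X) hlt
      exact hcon D (hDX.trans hX) hD
    obtain ⟨X, hXA, hX⟩ := hex A hA hcard
    obtain ⟨Y, hYA, hY⟩ := hex Aᶜ hA.compl (by rw [compl_compl]; exact hcard.symm)
    exact (hA.tightPair hcard hXA hYA hX hY hS).pairBound hG hV

lemma IsTree.pairBound (hG : G.IsTree) {s : ℕ} (hV : Fintype.card V = 2 * s + 4) :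
    G.PairBound s := by
  rcases (G.avoidableSets 2).eq_empty_or_nonempty with h | ⟨S, hS⟩
  · exact .linear (by simp [h])
  obtain ⟨A, hA⟩ := hG.exists_isColourClass
  obtain ⟨h1, -, m, hm⟩ := mem_avoidableSets.1 hS
  have h2 := hm.card_add_card_inter hA
  have h3 := card_inter_add_card_compl_inter A S
  -- The three cases are one, two or no avoided vertices in `A`.
  have h4 : #A = #Aᶜ ∨ #A = #Aᶜ + 2 ∨ #Aᶜ = #A + 2 := by omega
  rcases h4 with h4 | h4 | h4
  · exact hA.pairBound_of_card_eq hG hV h4 hS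
  · exact hA.pairBound_of_card_eq_add_two hG hV h4
  · exact hA.compl.pairBound_of_card_eq_add_two hG hV (by rw [compl_compl]; exact h4)

/-! ### Optimisation over the parameters -/

/-- The maximum number of strong almost-perfect matchings in a tree of order `2 * s + 4`. -/
def evenMax (s : ℕ) : ℕ :=
  if s = 0 then 3 else if s = 1 then 4 else if s ≤ 5 then 2 * s + 1
  else if s ≤ 12 then (s + 2) ^ 2 / 4 - 1 else s ^ 2 / 3

/-- The parameters of the extremal spider-trios of order `2 * s + 4`. -/
def IsExtremalTrio (s a b c : ℕ) : Prop :=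
  a + b + c = s ∧ s ≠ 1 ∧ ((s ≤ 5 ∧ b = 0 ∧ c = 0) ∨ (5 ≤ s ∧ s ≤ 12 ∧ a ≤ b + 1 ∧ c = 0) ∨
    (12 ≤ s ∧ a ≤ c + 1))

lemma sq_div_three (s : ℕ) : s ^ 2 ≤ 3 * (s ^ 2 / 3) + 1 := by
  have h : s ^ 2 % 3 ≤ 1 := by
    rw [Nat.pow_mod]
    have : s % 3 < 3 := Nat.mod_lt _ (by norm_num)
    interval_cases s % 3 <;> norm_num
  have := Nat.div_add_mod (s ^ 2) 3
  omega

lemma sq_div_four (s : ℕ) : s ^ 2 ≤ 4 * (s ^ 2 / 4) + 1 := by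
  have h : s ^ 2 % 4 ≤ 1 := by
    rw [Nat.pow_mod]
    have : s % 4 < 4 := Nat.mod_lt _ (by norm_num)
    interval_cases s % 4 <;> norm_num
  have := Nat.div_add_mod (s ^ 2) 4
  omega

lemma three_mul_le_sq {a b c s : ℕ} (h : a + b + c ≤ s) :
    a * b + a * c + b * c ≤ s ^ 2 / 3 := by
  rw [Nat.le_div_iff_mul_le (by norm_num)]
  have h1 : (a + b + c) ^ 2 ≤ s ^ 2 := Nat.pow_le_pow_left h 2
  refine le_trans ?_ h1
  zify
  nlinarith [sq_nonneg ((a : ℤ) - b), sq_nonneg ((a : ℤ) - c), sq_nonneg ((b : ℤ) - c)]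

lemma four_mul_le_sq {a b s : ℕ} (h : a + b ≤ s) : a * b ≤ s ^ 2 / 4 := by
  rw [Nat.le_div_iff_mul_le (by norm_num)]
  have h1 : (a + b) ^ 2 ≤ s ^ 2 := Nat.pow_le_pow_left h 2
  refine le_trans ?_ h1
  zify
  nlinarith [sq_nonneg ((a : ℤ) - b)]

/-- With differences `d = b - c` and `e = a - b`, the square of the sum minus three times the pair
sum is `d ^ 2 + d * e + e ^ 2`. This is at least 3 once `d + e ≥ 2`, more than the rounding allows.
The hypothesis `2 ≤ s` is needed since `s ^ 2 / 3` does not grow from 0 to 1. -/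
lemma eq_of_sq_div_three_le {a b c s : ℕ} (hab : b ≤ a) (hbc : c ≤ b) (h : a + b + c ≤ s)
    (hs : 2 ≤ s) (hge : s ^ 2 / 3 ≤ a * b + a * c + b * c) : a + b + c = s ∧ a ≤ c + 1 := by
  have h1 := sq_div_three s
  obtain ⟨d, rfl⟩ := Nat.exists_eq_add_of_le hbc
  obtain ⟨e, rfl⟩ := Nat.exists_eq_add_of_le hab
  have hsum : c + d + e + (c + d) + c = s := by
    by_contra hne
    have h2 := three_mul_le_sq (a := c + d + e) (b := c + d) (c := c) (s := s - 1) (by omega)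
    obtain ⟨t, rfl⟩ := Nat.exists_eq_add_of_le hs
    have h3 : 3 * ((2 + t - 1) ^ 2 / 3) ≤ (2 + t - 1) ^ 2 := Nat.mul_div_le _ _
    rw [show 2 + t - 1 = t + 1 by omega] at h2 h3
    nlinarith
  refine ⟨hsum, ?_⟩
  by_contra hlt
  have h2 : 2 ≤ d + e := by omega
  have h3 : 3 ≤ d ^ 2 + d * e + e ^ 2 := by
    rcases Nat.eq_zero_or_pos d with rfl | hd
    · nlinarith
    · rcases Nat.eq_zero_or_pos e with rfl | he
      · nlinarith
      · nlinarith
  subst hsum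
  nlinarith

lemma eq_of_sq_div_four_le {a b s : ℕ} (hab : b ≤ a) (h : a + b ≤ s)
    (hs : 2 ≤ s) (hge : s ^ 2 / 4 ≤ a * b) : a + b = s ∧ a ≤ b + 1 := by
  have h1 := sq_div_four s
  obtain ⟨e, rfl⟩ := Nat.exists_eq_add_of_le hab
  have hsum : b + e + b = s := by
    by_contra hne
    have h2 := four_mul_le_sq (a := b + e) (b := b) (s := s - 1) (by omega)
    obtain ⟨t, rfl⟩ := Nat.exists_eq_add_of_le hs
    have h3 : 4 * ((2 + t - 1) ^ 2 / 4) ≤ (2 + t - 1) ^ 2 := Nat.mul_div_le _ _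
    rw [show 2 + t - 1 = t + 1 by omega] at h2 h3
    nlinarith
  refine ⟨hsum, ?_⟩
  by_contra hlt
  have h2 : 2 ≤ e := by omega
  subst hsum
  nlinarith

/-- From `s = 13` on, three spiders with legs strictly beat the other candidates. The first
inequality is `(s + 2) ^ 2 / 4 - 1 < s ^ 2 / 3` with the subtraction cleared. -/
lemma two_mul_lt_sq_div_three {s : ℕ} (hs : 13 ≤ s) :
    (s + 2) ^ 2 / 4 < s ^ 2 / 3 + 1 ∧ 2 * s + 1 < s ^ 2 / 3 ∧ (s + 1) ^ 2 / 4 < s ^ 2 / 3 := by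
  have h1 := sq_div_three s
  have h2 : 4 * ((s + 2) ^ 2 / 4) ≤ (s + 2) ^ 2 := Nat.mul_div_le _ _
  have h3 : 4 * ((s + 1) ^ 2 / 4) ≤ (s + 1) ^ 2 := Nat.mul_div_le _ _
  refine ⟨?_, ?_, ?_⟩ <;> nlinarith

/-- The count depends on how many spiders have no legs: `2 * max a 1 + 1` if `b = c = 0`, `(a + 1) *
(b + 1) - 1` if only `c = 0`, and the pair sum otherwise. The three maxima for given `s` tie at `s =
5` (both 11) and at `s = 12` (both 48), where the extremal shape changes. -/
lemma trioCount_le_evenMax {s a b c : ℕ} (hab : b ≤ a) (hbc : c ≤ b) (h : a + b + c ≤ s) :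
    trioCount a b c ≤ evenMax s ∧ (evenMax s ≤ trioCount a b c → IsExtremalTrio s a b c) := by
  rcases Nat.eq_zero_or_pos c with rfl | hc
  · rcases Nat.eq_zero_or_pos b with rfl | hb
    · have h1 : trioCount a 0 0 = 2 * max a 1 + 1 := by simp [trioCount]; ring
      rw [h1]
      by_cases hs : s ≤ 12
      · unfold evenMax IsExtremalTrio
        interval_cases s <;> simp <;> omega
      · have h2 := two_mul_lt_sq_div_three (s := s) (by omega)
        have h3 : evenMax s = s ^ 2 / 3 := by
          unfold evenMax; simp [show s ≠ 0 by omega, show s ≠ 1 by omega, show ¬ s ≤ 5 by omega, hs]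
        rw [h3]
        omega
    · have h1 : trioCount a b 0 + 1 = (a + 1) * (b + 1) := by
        simp [trioCount, show max b 1 = b by omega, show max a 1 = a by omega]; ring
      have h2 := four_mul_le_sq (a := a + 1) (b := b + 1) (s := s + 2) (by omega)
      have h3 := eq_of_sq_div_four_le (a := a + 1) (b := b + 1) (s := s + 2) (by omega) (by omega)
        (by omega)
      rw [← h1] at h2 h3
      by_cases hs : s ≤ 12
      · unfold evenMax IsExtremalTrio
        interval_cases s <;> simp at h2 h3 ⊢ <;> omega
      · have h4 := two_mul_lt_sq_div_three (s := s) (by omega)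
        have h5 : evenMax s = s ^ 2 / 3 := by
          unfold evenMax; simp [show s ≠ 0 by omega, show s ≠ 1 by omega, show ¬ s ≤ 5 by omega, hs]
        rw [h5]
        omega
  · have h1 : trioCount a b c = a * b + a * c + b * c := by
      simp [trioCount, show max c 1 = c by omega, show max b 1 = b by omega,
        show max a 1 = a by omega]
    have h2 := three_mul_le_sq h
    have h3 := eq_of_sq_div_three_le hab hbc h (by omega)
    rw [← h1] at h2 h3
    by_cases hs : s ≤ 12
    · unfold evenMax IsExtremalTrio
      interval_cases s <;> simp at h2 h3 ⊢ <;> omega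
    · have h5 : evenMax s = s ^ 2 / 3 := by
        unfold evenMax; simp [show s ≠ 0 by omega, show s ≠ 1 by omega, show ¬ s ≤ 5 by omega, hs]
      rw [h5]
      refine ⟨h2, fun h => ⟨(h3 h).1, by omega, .inr (.inr ⟨by omega, (h3 h).2⟩)⟩⟩

lemma lt_evenMax {s : ℕ} : s + 1 < evenMax s := by
  by_cases hs : s ≤ 12
  · unfold evenMax
    interval_cases s <;> simp
  · have h2 := two_mul_lt_sq_div_three (s := s) (by omega)
    have h3 : evenMax s = s ^ 2 / 3 := by
      unfold evenMax; simp [show s ≠ 0 by omega, show s ≠ 1 by omega, show ¬ s ≤ 5 by omega, hs]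
    omega

lemma mul_lt_evenMax {s x y : ℕ} (h : x + y ≤ s + 1) : x * y < evenMax s := by
  have h1 := four_mul_le_sq h
  generalize x * y = z at h1 ⊢
  by_cases hs : s ≤ 12
  · unfold evenMax
    interval_cases s <;> simp at h1 ⊢ <;> omega
  · have h2 := two_mul_lt_sq_div_three (s := s) (by omega)
    have h3 : evenMax s = s ^ 2 / 3 := by
      unfold evenMax; simp [show s ≠ 0 by omega, show s ≠ 1 by omega, show ¬ s ≤ 5 by omega, hs]
    omega

/-- For `s = 1`, taking `p = q = 1` gives 4, which equals the maximum; this is the double broom.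
Otherwise, if `p` or `q` is 1, the product is at most `2 * s`. -/
lemma max_mul_max_lt_evenMax {s p q : ℕ} (hp : 0 < p) (hq : 0 < q) (h : p + q ≤ s + 1)
    (hs : s ≠ 1) : max p 2 * max q 2 < evenMax s := by
  have key : 2 ≤ s → 2 * s < evenMax s := by
    by_cases hs : s ≤ 12
    · unfold evenMax
      interval_cases s <;> simp
    · have h2 := two_mul_lt_sq_div_three (s := s) (by omega)
      have h3 : evenMax s = s ^ 2 / 3 := by
        unfold evenMax; simp [show s ≠ 0 by omega, show s ≠ 1 by omega, show ¬ s ≤ 5 by omega, hs]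
      omega
  by_cases hp2 : 2 ≤ p
  · by_cases hq2 : 2 ≤ q
    · rw [max_eq_left hp2, max_eq_left hq2]
      exact mul_lt_evenMax h
    · have : q = 1 := by omega
      subst this
      rw [max_eq_left hp2, max_eq_right one_le_two]
      omega
  · have : p = 1 := by omega
    subst this
    rw [max_eq_right one_le_two]
    omega

/-- The upper bound for trees of even order, with the possible cases of equality. -/
lemma IsTree.card_avoidableSets_two_le (hG : G.IsTree) {s : ℕ}
    (hV : Fintype.card V = 2 * s + 4) : #(G.avoidableSets 2) ≤ evenMax s ∧
      (#(G.avoidableSets 2) = evenMax s → (s = 1 ∧ Nonempty (G ≃g doubleBroom 2 2)) ∨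
        ∃ a b c, b ≤ a ∧ c ≤ b ∧ IsExtremalTrio s a b c ∧ Nonempty (G ≃g spiderTrio a b c)) := by
  rcases hG.pairBound hV with ⟨a, b, c, hab, hbc, h1, h2, h3⟩ | ⟨p, q, hp, hq, hpq, hle, hiso⟩ |
    h | ⟨x, y, hxy, h⟩
  · obtain ⟨h4, h5⟩ := trioCount_le_evenMax (s := s) hab hbc (by omega)
    refine ⟨h2.trans h4, fun h => .inr ⟨a, b, c, hab, hbc, h5 (by omega), ?_⟩⟩
    have h6 := (h5 (by omega)).1
    exact h3 (by omega) (by omega)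
  · by_cases hs : s = 1
    · subst hs
      have h1 : p = 1 := by omega
      have h2 : q = 1 := by omega
      subst h1 h2
      have h3 : evenMax 1 = 4 := rfl
      simp at hle
      rw [h3]
      exact ⟨hle, fun h => .inl ⟨rfl, hiso rfl h.ge⟩⟩
    · have := max_mul_max_lt_evenMax hp hq hpq hs
      omega
  · have := lt_evenMax (s := s)
    omega
  · have := mul_lt_evenMax hxy
    omega


/-! ### Invariance under isomorphism -/

lemma Iso.card_avoidableSets_le {W : Type*} [Fintype W] {H : SimpleGraph W} (e : G ≃g H) (k : ℕ) :
    #(G.avoidableSets k) ≤ #(H.avoidableSets k) := by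
  refine card_le_card_of_injOn (fun S => S.map e.toEquiv.toEmbedding) ?_
    ((Finset.map_injective _).injOn)
  intro S hS
  rw [mem_coe, mem_avoidableSets] at hS ⊢
  obtain ⟨h1, h2, m, hm⟩ := hS
  refine ⟨by rw [card_map, h1], ?_, fun w => e (m (e.symm w)), ?_⟩
  · intro w hw
    obtain ⟨v, hv, rfl⟩ := mem_map.1 hw
    obtain ⟨x, hx⟩ := (h2 v hv).exists_adj_iff
    refine isLeafVertex_of_forall (w := e x) fun y => ?_
    have h3 := e.map_adj_iff (v := v) (w := e.symm y)
    rw [e.apply_symm_apply] at h3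
    show H.Adj (e v) y ↔ _
    rw [h3, hx, e.symm_apply_eq]
  · intro w hw
    have hw' : e.symm w ∉ S := fun h => hw (mem_map.2 ⟨_, h, e.apply_symm_apply w⟩)
    obtain ⟨h3, h4, h5⟩ := hm _ hw'
    refine ⟨fun h => ?_, ?_, ?_⟩
    · obtain ⟨v, hv, hv'⟩ := mem_map.1 h
      exact h3 (e.injective hv' ▸ hv)
    · have := (e.map_adj_iff).2 h4
      rwa [e.apply_symm_apply] at this
    · show e (m (e.symm (e (m (e.symm w))))) = w
      rw [e.symm_apply_apply, h5, e.apply_symm_apply]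

lemma Iso.card_avoidableSets_eq {W : Type*} [Fintype W] {H : SimpleGraph W} (e : G ≃g H) (k : ℕ) :
    #(G.avoidableSets k) = #(H.avoidableSets k) :=
  le_antisymm (e.card_avoidableSets_le k) (e.symm.card_avoidableSets_le k)

/-! ### Spiders -/

/-- The leaves of a spider; the centre, if there are no legs. -/
noncomputable def spiderEnds (k : ℕ) : Finset (Option (Fin k × Bool)) :=
  univ.filter fun | none => k = 0 | some (_, t) => t = true

lemma none_mem_spiderEnds {k : ℕ} : none ∈ spiderEnds k ↔ k = 0 := by simp [spiderEnds]

lemma some_mem_spiderEnds {k : ℕ} {i : Fin k} {t : Bool} :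
    some (i, t) ∈ spiderEnds k ↔ t = true := by simp [spiderEnds]

lemma card_spiderEnds (k : ℕ) : #(spiderEnds k) = max k 1 := by
  rcases Nat.eq_zero_or_pos k with rfl | hk
  · have : spiderEnds 0 = {none} := by
      ext x
      rcases x with _ | ⟨i, -⟩
      · simp [none_mem_spiderEnds]
      · exact i.elim0
    simp [this]
  · have : spiderEnds k = univ.image fun i : Fin k => some (i, true) := by
      ext x
      rcases x with _ | ⟨i, t⟩
      · simp [none_mem_spiderEnds, hk.ne']
      · simp [some_mem_spiderEnds, eq_comm]
    rw [this, card_image_of_injective]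
    · simp; omega
    · intro i j h
      simpa using h

lemma spider_coversOff_center (k : ℕ) : ∃ m, (spider k).CoversOff {none} m := by
  refine ⟨fun | none => none | some (i, t) => some (i, !t), ?_⟩
  rintro (_ | ⟨i, _ | _⟩) h <;> simp [spider] at h ⊢

/-- Avoiding the leaf of leg `j` frees its middle vertex, which is matched to the centre. Without
legs the centre itself is the avoided end. -/
lemma spider_coversOff_end {k : ℕ} {x : Option (Fin k × Bool)} (hx : x ∈ spiderEnds k) :
    ∃ m, (spider k).CoversOff {x} m := by
  rcases x with _ | ⟨j, t⟩
  · exact spider_coversOff_center k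
  · rw [some_mem_spiderEnds] at hx
    subst hx
    refine ⟨fun | none => some (j, false)
                | some (i, t) => if i = j then none else some (i, !t), ?_⟩
    rintro (_ | ⟨i, t⟩) h
    · simp [spider]
    · by_cases hij : i = j
      · cases t <;> simp [spider, hij] at h ⊢
      · cases t <;> simp [spider, hij] at h ⊢

lemma le_card_avoidableSets_spider {k : ℕ} (hk : 0 < k) :
    k ≤ #((spider k).avoidableSets 1) := by
  have h1 : k ≤ #(spiderEnds k) := by rw [card_spiderEnds]; omega
  refine h1.trans (card_le_card_of_injOn (fun x => {x}) ?_ (singleton_injective.injOn))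
  intro x hx
  rw [mem_coe] at hx ⊢
  refine mem_avoidableSets.2 ⟨card_singleton x, ?_, spider_coversOff_end hx⟩
  intro v hv
  rw [mem_singleton] at hv
  subst hv
  rcases v with _ | ⟨j, t⟩
  · rw [none_mem_spiderEnds] at hx
    omega
  · rw [some_mem_spiderEnds] at hx
    subst hx
    refine isLeafVertex_of_forall (w := some (j, false)) ?_
    rintro (_ | ⟨i, _ | _⟩) <;> simp [spider]

/-! ### Spider-trios -/

section Trio

variable {a b c : ℕ}

lemma spiderTrio_isLeaf_left {x : Option (Fin a × Bool)} (hx : x ∈ spiderEnds a) :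
    (spiderTrio a b c).IsLeafVertex (some (.inl x)) := by
  rcases x with _ | ⟨j, t⟩
  · rw [none_mem_spiderEnds] at hx
    subst hx
    refine isLeafVertex_of_forall (w := none) ?_
    rintro (_ | ((_ | y) | (y | y)))
    · simp [spiderTrio, addVertex]
    · simp
    · exact y.1.elim0
    all_goals simp [spiderTrio, addVertex]
  · rw [some_mem_spiderEnds] at hx
    subst hx
    refine isLeafVertex_of_forall (w := some (.inl (some (j, false)))) ?_
    rintro (_ | ((_ | ⟨i, _ | _⟩) | (y | y))) <;> simp [spiderTrio, addVertex, spider]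

lemma spiderTrio_isLeaf_middle {x : Option (Fin b × Bool)} (hx : x ∈ spiderEnds b) :
    (spiderTrio a b c).IsLeafVertex (some (.inr (.inl x))) := by
  rcases x with _ | ⟨j, t⟩
  · rw [none_mem_spiderEnds] at hx
    subst hx
    refine isLeafVertex_of_forall (w := none) ?_
    rintro (_ | (y | ((_ | y) | y)))
    · simp [spiderTrio, addVertex]
    · simp [spiderTrio, addVertex]
    · simp
    · exact y.1.elim0
    · simp [spiderTrio, addVertex]
  · rw [some_mem_spiderEnds] at hx
    subst hx
    refine isLeafVertex_of_forall (w := some (.inr (.inl (some (j, false))))) ?_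
    rintro (_ | (y | ((_ | ⟨i, _ | _⟩) | y))) <;> simp [spiderTrio, addVertex, spider]

lemma spiderTrio_isLeaf_right {x : Option (Fin c × Bool)} (hx : x ∈ spiderEnds c) :
    (spiderTrio a b c).IsLeafVertex (some (.inr (.inr x))) := by
  rcases x with _ | ⟨j, t⟩
  · rw [none_mem_spiderEnds] at hx
    subst hx
    refine isLeafVertex_of_forall (w := none) ?_
    rintro (_ | (y | (y | (_ | y))))
    · simp [spiderTrio, addVertex]
    · simp [spiderTrio, addVertex]
    · simp [spiderTrio, addVertex]
    · simp
    · exact y.1.elim0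
  · rw [some_mem_spiderEnds] at hx
    subst hx
    refine isLeafVertex_of_forall (w := some (.inr (.inr (some (j, false))))) ?_
    rintro (_ | (y | (y | (_ | ⟨i, _ | _⟩)))) <;> simp [spiderTrio, addVertex, spider]

/-- Two of the spiders avoid one end each; the new vertex is matched to the centre of the third,
whose legs are matched internally. -/
lemma mem_avoidable_left_middle {x : Option (Fin a × Bool)} {y : Option (Fin b × Bool)}
    (hx : x ∈ spiderEnds a) (hy : y ∈ spiderEnds b) :
    {some (.inl x), some (.inr (.inl y))} ∈ (spiderTrio a b c).avoidableSets 2 := by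
  obtain ⟨m₁, h₁⟩ := spider_coversOff_end hx
  obtain ⟨m₂, h₂⟩ := spider_coversOff_end hy
  obtain ⟨m₃, h₃⟩ := spider_coversOff_center c
  refine mem_avoidableSets.2 ⟨card_pair (by simp), ?_,
    fun | none => some (.inr (.inr none))
        | some (.inl v) => some (.inl (m₁ v))
        | some (.inr (.inl v)) => some (.inr (.inl (m₂ v)))
        | some (.inr (.inr v)) => if v = none then none else some (.inr (.inr (m₃ v))), ?_⟩
  · intro v hv
    rw [mem_insert, mem_singleton] at hv
    rcases hv with rfl | rfl
    exacts [spiderTrio_isLeaf_left hx, spiderTrio_isLeaf_middle hy]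
  · rintro (_ | (v | (v | v))) hv
    · simp [spiderTrio, addVertex]
    · simpa [spiderTrio, addVertex] using h₁ v (by simpa using hv)
    · simpa [spiderTrio, addVertex] using h₂ v (by simpa using hv)
    · by_cases hn : v = none
      · simp [spiderTrio, addVertex, hn]
      · have := h₃ v (by simpa using hn)
        simp only [mem_singleton] at this
        simpa [spiderTrio, addVertex, hn, this.1] using this.2

lemma mem_avoidable_left_right {x : Option (Fin a × Bool)} {y : Option (Fin c × Bool)}
    (hx : x ∈ spiderEnds a) (hy : y ∈ spiderEnds c) :
    {some (.inl x), some (.inr (.inr y))} ∈ (spiderTrio a b c).avoidableSets 2 := by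
  obtain ⟨m₁, h₁⟩ := spider_coversOff_end hx
  obtain ⟨m₂, h₂⟩ := spider_coversOff_center b
  obtain ⟨m₃, h₃⟩ := spider_coversOff_end hy
  refine mem_avoidableSets.2 ⟨card_pair (by simp), ?_,
    fun | none => some (.inr (.inl none))
        | some (.inl v) => some (.inl (m₁ v))
        | some (.inr (.inl v)) => if v = none then none else some (.inr (.inl (m₂ v)))
        | some (.inr (.inr v)) => some (.inr (.inr (m₃ v))), ?_⟩
  · intro v hv
    rw [mem_insert, mem_singleton] at hv
    rcases hv with rfl | rfl
    exacts [spiderTrio_isLeaf_left hx, spiderTrio_isLeaf_right hy]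
  · rintro (_ | (v | (v | v))) hv
    · simp [spiderTrio, addVertex]
    · simpa [spiderTrio, addVertex] using h₁ v (by simpa using hv)
    · by_cases hn : v = none
      · simp [spiderTrio, addVertex, hn]
      · have := h₂ v (by simpa using hn)
        simp only [mem_singleton] at this
        simpa [spiderTrio, addVertex, hn, this.1] using this.2
    · simpa [spiderTrio, addVertex] using h₃ v (by simpa using hv)

lemma mem_avoidable_middle_right {x : Option (Fin b × Bool)} {y : Option (Fin c × Bool)}
    (hx : x ∈ spiderEnds b) (hy : y ∈ spiderEnds c) :
    {some (.inr (.inl x)), some (.inr (.inr y))} ∈ (spiderTrio a b c).avoidableSets 2 := by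
  obtain ⟨m₁, h₁⟩ := spider_coversOff_center a
  obtain ⟨m₂, h₂⟩ := spider_coversOff_end hx
  obtain ⟨m₃, h₃⟩ := spider_coversOff_end hy
  refine mem_avoidableSets.2 ⟨card_pair (by simp), ?_,
    fun | none => some (.inl none)
        | some (.inl v) => if v = none then none else some (.inl (m₁ v))
        | some (.inr (.inl v)) => some (.inr (.inl (m₂ v)))
        | some (.inr (.inr v)) => some (.inr (.inr (m₃ v))), ?_⟩
  · intro v hv
    rw [mem_insert, mem_singleton] at hv
    rcases hv with rfl | rfl
    exacts [spiderTrio_isLeaf_middle hx, spiderTrio_isLeaf_right hy]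
  · rintro (_ | (v | (v | v))) hv
    · simp [spiderTrio, addVertex]
    · by_cases hn : v = none
      · simp [spiderTrio, addVertex, hn]
      · have := h₁ v (by simpa using hn)
        simp only [mem_singleton] at this
        simpa [spiderTrio, addVertex, hn, this.1] using this.2
    · simpa [spiderTrio, addVertex] using h₂ v (by simpa using hv)
    · simpa [spiderTrio, addVertex] using h₃ v (by simpa using hv)

lemma disjoint_crossPairs {X Y Z W : Finset V} (h : Disjoint Z X)
    (h' : Disjoint Z Y) :
    Disjoint (crossPairs X Y) (crossPairs Z W) ∧ Disjoint (crossPairs X Y) (crossPairs W Z) := by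
  have key : ∀ S ∈ crossPairs X Y, ∀ z ∈ Z, z ∉ S := by
    intro S hS z hz hzS
    obtain ⟨x, hx, y, hy, rfl⟩ := mem_crossPairs.1 hS
    rw [mem_insert, mem_singleton] at hzS
    rcases hzS with rfl | rfl
    exacts [Finset.disjoint_left.1 h hz hx, Finset.disjoint_left.1 h' hz hy]
  constructor <;> rw [Finset.disjoint_left] <;> intro S hS hS'
  · obtain ⟨z, hz, w, -, rfl⟩ := mem_crossPairs.1 hS'
    exact key _ hS z hz (by simp)
  · obtain ⟨w, -, z, hz, rfl⟩ := mem_crossPairs.1 hS'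
    exact key _ hS z hz (by simp)

lemma trioCount_le_card_avoidableSets (a b c : ℕ) :
    trioCount a b c ≤ #((spiderTrio a b c).avoidableSets 2) := by
  set X := (spiderEnds a).image fun x => (some (.inl x) :
    Option (Option (Fin a × Bool) ⊕ (Option (Fin b × Bool) ⊕ Option (Fin c × Bool)))) with hX
  set Y := (spiderEnds b).image fun x => (some (.inr (.inl x)) :
    Option (Option (Fin a × Bool) ⊕ (Option (Fin b × Bool) ⊕ Option (Fin c × Bool)))) with hY
  set Z := (spiderEnds c).image fun x => (some (.inr (.inr x)) :
    Option (Option (Fin a × Bool) ⊕ (Option (Fin b × Bool) ⊕ Option (Fin c × Bool)))) with hZ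
  have cX : #X = max a 1 := by
    rw [hX, card_image_of_injective, card_spiderEnds]
    intro x y h
    simpa using h
  have cY : #Y = max b 1 := by
    rw [hY, card_image_of_injective, card_spiderEnds]
    intro x y h
    simpa using h
  have cZ : #Z = max c 1 := by
    rw [hZ, card_image_of_injective, card_spiderEnds]
    intro x y h
    simpa using h
  have hXY : Disjoint X Y := by
    rw [Finset.disjoint_left]; simp [hX, hY]
  have hXZ : Disjoint X Z := by
    rw [Finset.disjoint_left]; simp [hX, hZ]
  have hYZ : Disjoint Y Z := by
    rw [Finset.disjoint_left]; simp [hY, hZ]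
  have hsub : (crossPairs X Y ∪ crossPairs X Z) ∪ crossPairs Y Z ⊆
      (spiderTrio a b c).avoidableSets 2 := by
    refine union_subset (union_subset ?_ ?_) ?_ <;> intro S hS <;>
      obtain ⟨x, hx, y, hy, rfl⟩ := mem_crossPairs.1 hS <;>
      obtain ⟨x, hx', rfl⟩ := mem_image.1 hx <;> obtain ⟨y, hy', rfl⟩ := mem_image.1 hy
    exacts [mem_avoidable_left_middle hx' hy', mem_avoidable_left_right hx' hy',
      mem_avoidable_middle_right hx' hy']
  have h1 := card_le_card hsub
  rw [card_union_of_disjoint, card_union_of_disjoint, card_crossPairs hXY, card_crossPairs hXZ,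
    card_crossPairs hYZ, cX, cY, cZ] at h1
  · exact h1
  · exact (disjoint_crossPairs hXZ.symm hYZ.symm).2
  · rw [disjoint_union_left]
    exact ⟨(disjoint_crossPairs hXZ.symm hYZ.symm).2, (disjoint_crossPairs hXY.symm hYZ).1⟩

end Trio

lemma pair_mem_avoidableSets {x y : V} (hxy : x ≠ y) (hx : G.IsLeafVertex x)
    (hy : G.IsLeafVertex y) (m : V → V)
    (hm : ∀ v, v ≠ x → v ≠ y → (m v ≠ x ∧ m v ≠ y) ∧ G.Adj v (m v) ∧ m (m v) = v) :
    {x, y} ∈ G.avoidableSets 2 := by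
  refine mem_avoidableSets.2 ⟨card_pair hxy, ?_, m, fun v hv => ?_⟩
  · intro v hv
    rw [mem_insert, mem_singleton] at hv
    rcases hv with rfl | rfl <;> assumption
  · rw [mem_insert, mem_singleton, not_or] at hv ⊢
    exact hm v hv.1 hv.2

lemma four_le_card_avoidableSets_doubleBroom : 4 ≤ #((doubleBroom 2 2).avoidableSets 2) := by
  set X := (univ : Finset (Fin 2)).image
    fun i => (.inl (some i) : Option (Fin 2) ⊕ Option (Fin 2)) with hX
  set Y := (univ : Finset (Fin 2)).image
    fun i => (.inr (some i) : Option (Fin 2) ⊕ Option (Fin 2)) with hY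
  have cX : #X = 2 := by
    rw [hX, card_image_of_injective, card_univ, Fintype.card_fin]
    intro x y h
    simpa using h
  have cY : #Y = 2 := by
    rw [hY, card_image_of_injective, card_univ, Fintype.card_fin]
    intro x y h
    simpa using h
  have hXY : Disjoint X Y := by
    rw [Finset.disjoint_left]; simp [hX, hY]
  have hsub : crossPairs X Y ⊆ (doubleBroom 2 2).avoidableSets 2 := by
    intro S hS
    obtain ⟨x, hx, y, hy, rfl⟩ := mem_crossPairs.1 hS
    obtain ⟨i, -, rfl⟩ := mem_image.1 hx
    obtain ⟨j, -, rfl⟩ := mem_image.1 hy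
    refine pair_mem_avoidableSets (by simp) ?_ ?_
      -- In `Fin 2`, `i + 1` is the leaf other than the avoided leaf `i`.
      (fun | .inl none => .inl (some (i + 1)) | .inl (some _) => .inl none
           | .inr none => .inr (some (j + 1)) | .inr (some _) => .inr none) ?_
    · refine isLeafVertex_of_forall (w := .inl none) ?_
      rintro ((_ | k) | (_ | k)) <;> simp [doubleBroom, starGraph, edge_adj]
    · refine isLeafVertex_of_forall (w := .inr none) ?_
      rintro ((_ | k) | (_ | k)) <;> simp [doubleBroom, starGraph, edge_adj]
    · have heq : ∀ i k : Fin 2, k ≠ i → i + 1 = k := by decide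
      rintro ((_ | k) | (_ | k)) h h' <;> simp [doubleBroom, starGraph, edge_adj] at h h' ⊢
      · exact heq i k h
      · exact heq j k h'
  have h1 := card_le_card hsub
  rw [card_crossPairs hXY, cX, cY] at h1
  exact h1

/-! ### Other descriptions of small spider-trios -/

lemma nonempty_spiderTrio_iso_starGraph :
    Nonempty (spiderTrio 0 0 0 ≃g starGraph (0 : Fin 4)) := by
  refine (spiderTrio_isTree 0 0 0).nonempty_iso_of_surjective ?_
    (fun i : Fin 4 => ![none, some (.inl none), some (.inr (.inl none)),
      some (.inr (.inr none))] i) ?_ ?_ ?_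
  · refine connected_of_parent 0 (fun _ => 0) (fun i => i.val) ?_ ?_
    · intro x hx
      simpa using Fin.pos_iff_ne_zero.2 hx
    · intro x hx
      simp [starGraph, hx]
  · intro i j h
    fin_cases i <;> fin_cases j <;> simp [starGraph, spiderTrio, addVertex] at h ⊢
  · rintro (_ | ((_ | ⟨i, -⟩) | ((_ | ⟨i, -⟩) | (_ | ⟨i, -⟩))))
    exacts [⟨0, rfl⟩, ⟨1, rfl⟩, i.elim0, ⟨2, rfl⟩, i.elim0, ⟨3, rfl⟩, i.elim0]
  · rw [card_spiderTrio]
    simp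

/-- The middle vertex of leg `0` plays the role of the new vertex of the trio: its two leaves are
the legless spiders, and the remaining `s` legs hang from the centre. -/
lemma nonempty_spiderTrio_iso_addVertex (s k : ℕ) (hk : k = s + 1) :
    Nonempty (spiderTrio s 0 0 ≃g
      (spider k).addVertex {v | ∃ i, i.val = 0 ∧ v = some (i, false)}) := by
  subst hk
  refine (spiderTrio_isTree s 0 0).nonempty_iso_of_surjective ?_
    (fun | none => some (.inr (.inr none))
         | some none => some (.inl none)
         | some (some (i, t)) => Fin.cases
            (if t then some (.inr (.inl none)) else none) (fun j => some (.inl (some (j, t)))) i)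
    ?_ ?_ ?_
  · refine connected_of_parent (some none)
      (fun | none => some (some (0, false)) | some x => some (spiderParent x))
      (fun | none => 2 | some x => spiderDepth x) ?_ ?_
    · rintro (_ | x) hx
      · simp [spiderDepth]
      · exact spiderDepth_lt x (by simpa using hx)
    · rintro (_ | x) hx
      · simp [addVertex]
      · exact spider_adj_parent x (by simpa using hx)
  · rintro (_ | (_ | ⟨i, t⟩)) (_ | (_ | ⟨j, t'⟩)) h
    · simp [addVertex] at h
    · simp [addVertex] at h
    · obtain ⟨i, hi, h⟩ := (h : some (j, t') ∈ {v | ∃ i, i.val = 0 ∧ v = some (i, false)})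
      simp only [Option.some.injEq, Prod.mk.injEq] at h
      obtain ⟨rfl, rfl⟩ := h
      obtain rfl : j = 0 := Fin.ext hi
      simp [spiderTrio, addVertex]
    · simp [addVertex] at h
    · simp [addVertex] at h
    · cases j using Fin.cases <;> cases t' <;> simp [addVertex, spider, spiderTrio] at h ⊢
    · obtain ⟨j, hj, h⟩ := (h : some (i, t) ∈ {v | ∃ i, i.val = 0 ∧ v = some (i, false)})
      simp only [Option.some.injEq, Prod.mk.injEq] at h
      obtain ⟨rfl, rfl⟩ := h
      obtain rfl : i = 0 := Fin.ext hj
      simp [spiderTrio, addVertex]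
    · cases i using Fin.cases <;> cases t <;> simp [addVertex, spider, spiderTrio] at h ⊢
    · cases i using Fin.cases <;> cases j using Fin.cases <;> cases t <;> cases t' <;>
        simp [addVertex, spider, spiderTrio] at h ⊢ <;>
        first | exact h | exact absurd h.symm (Fin.succ_ne_zero _)
  · rintro (_ | ((_ | ⟨i, t⟩) | ((_ | ⟨i, -⟩) | (_ | ⟨i, -⟩))))
    exacts [⟨some (some (0, false)), rfl⟩, ⟨some none, rfl⟩, ⟨some (some (i.succ, t)), rfl⟩,
      ⟨some (some (0, true)), rfl⟩, i.elim0, ⟨none, rfl⟩, i.elim0]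
  · rw [card_spiderTrio]
    simp
    omega

lemma nonempty_spiderTrio_iso_evenSpecialSpider (s n : ℕ) (hn : n = 2 * s + 4) :
    Nonempty (spiderTrio s 0 0 ≃g evenSpecialSpider n) :=
  nonempty_spiderTrio_iso_addVertex s _ (by omega)


/-! ### Trees of odd order -/

lemma mem_avoidableSets_singleton {u : V} (h : {u} ∈ G.avoidableSets 1) :
    G.IsLeafVertex u ∧ ∃ m, G.CoversOff {u} m := by
  obtain ⟨-, h1, h2⟩ := mem_avoidableSets.1 h
  exact ⟨h1 u (mem_singleton_self u), h2⟩

/-- Any two leaves of `L` have distinct neighbours, since `k ≥ 3` leaves a third one, and the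
matching avoiding it covers both. So `β` is a bijection from `L` to `Aᶜ`. Each `β u` must be
adjacent to `c`, as otherwise `{u, β u}` would be a component. -/
lemma IsTree.nonempty_iso_spider (hG : G.IsTree) {k : ℕ} (hk : 3 ≤ k)
    (hV : Fintype.card V = 2 * k + 1) {A L : Finset V} {c : V} (hA : G.IsColourClass A)
    (hcL : c ∉ L) (hAL : A = insert c L) (hLk : #L = k) (hL : ∀ u ∈ L, {u} ∈ G.avoidableSets 1) :
    Nonempty (G ≃g spider k) := by
  have hex : ∀ u, ∃ w, u ∈ L → ∀ x, G.Adj u x ↔ x = w := fun u => by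
    by_cases hu : u ∈ L
    · obtain ⟨w, hw⟩ := (mem_avoidableSets_singleton (hL u hu)).1.exists_adj_iff
      exact ⟨w, fun _ => hw⟩
    · exact ⟨u, fun h => absurd h hu⟩
  choose β hβ using hex
  have hadj : ∀ u ∈ L, G.Adj u (β u) := fun u hu => (hβ u hu _).2 rfl
  have hinj : ∀ u ∈ L, ∀ v ∈ L, β u = β v → u = v := by
    intro u hu v hv huv
    obtain ⟨w, hw, hwu, hwv⟩ : ∃ w ∈ L, u ≠ w ∧ v ≠ w := by
      by_contra! hcon
      have hsub : L ⊆ {u, v} := by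
        intro w hw
        rw [mem_insert, mem_singleton]
        by_cases h : u = w
        · exact .inl h.symm
        · exact .inr (hcon w hw h).symm
      have := card_le_card hsub
      have := card_le_two (a := u) (b := v)
      omega
    obtain ⟨-, m, hm⟩ := mem_avoidableSets_singleton (hL w hw)
    have hu' : u ∉ ({w} : Finset V) := by simpa using hwu
    have hv' : v ∉ ({w} : Finset V) := by simpa using hwv
    refine hm.injOn hu' hv' ?_
    rw [(hβ u hu _).1 (hm u hu').2.1, (hβ v hv _).1 (hm v hv').2.1, huv]
  have hLA : L ⊆ A := by
    rw [hAL]; exact subset_insert _ _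
  have hcard : #Aᶜ = k := by
    have := card_compl_add_card A
    rw [hAL, card_insert_of_notMem hcL] at this
    rw [hAL]
    omega
  have himg : L.image β = Aᶜ := by
    apply eq_of_subset_of_card_le
    · intro w hw
      obtain ⟨u, hu, rfl⟩ := mem_image.1 hw
      exact mem_compl.2 ((hA (hadj u hu)).1 (hLA hu))
    · rw [card_image_of_injOn fun u hu v hv => hinj u hu v hv]
      omega
  have hcβ : ∀ u ∈ L, G.Adj c (β u) := by
    intro u hu
    by_contra hna
    have hcl := hG.connected.eq_univ_of_closed (C := {u, β u}) ⟨u, by simp⟩ (fun x hx y hy => by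
      rw [mem_insert, mem_singleton] at hx ⊢
      rcases hx with rfl | rfl
      · exact .inr ((hβ x hu y).1 hy)
      · have h1 := (hA (hadj u hu)).1 (hLA hu)
        have h2 : y ∈ A := by
          have := hA hy
          tauto
        rw [hAL, mem_insert] at h2
        rcases h2 with rfl | h2
        · exact absurd hy.symm hna
        · exact .inl (hinj y h2 u hu ((hβ y h2 _).1 hy.symm).symm))
    have h1 := card_le_two (a := u) (b := β u)
    rw [hcl, card_univ] at h1
    omega
  let e : Fin k ≃ L := (finCongr (by rw [Fintype.card_coe, hLk])).trans (Fintype.equivFin L).symm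
  refine hG.nonempty_iso_of_surjective (spider_isTree k).connected
    (fun | none => c | some (j, false) => β (e j) | some (j, true) => e j) ?_ ?_
    (by rw [card_spider, hV])
  · rintro (_ | ⟨i, _ | _⟩) (_ | ⟨j, _ | _⟩) h <;> simp [spider] at h ⊢
    · exact hcβ _ (e j).2
    · exact (hcβ _ (e i).2).symm
    · subst h; exact (hadj _ (e i).2).symm
    · subst h; exact hadj _ (e j).2
  · intro v
    by_cases hv : v ∈ A
    · rw [hAL, mem_insert] at hv
      rcases hv with rfl | hv
      · exact ⟨none, rfl⟩
      · exact ⟨some (e.symm ⟨v, hv⟩, true), by simp⟩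
    · have : v ∈ L.image β := by rw [himg]; exact mem_compl.2 hv
      obtain ⟨u, hu, rfl⟩ := mem_image.1 this
      exact ⟨some (e.symm ⟨u, hu⟩, false), by simp⟩

/-- If all of `A` were leaves, any `b ∈ Aᶜ` and its neighbours would form a component, so `b` would
be the only vertex of `Aᶜ`. -/
lemma IsColourClass.exists_not_isLeafVertex (hG : G.IsTree) {A : Finset V}
    (hA : G.IsColourClass A) (hcard : 2 ≤ #Aᶜ) : ∃ c ∈ A, ¬ G.IsLeafVertex c := by
  by_contra! hcon
  obtain ⟨b, hb⟩ := card_pos.1 (by omega : 0 < #Aᶜ)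
  rw [mem_compl] at hb
  have hadj : ∀ x, G.Adj b x → x ∈ A := fun x hx => by
    have := hA hx
    tauto
  have hcl := hG.connected.eq_univ_of_closed (C := insert b (univ.filter fun x => G.Adj b x))
    ⟨b, by simp⟩ (fun x hx y hy => by
      simp only [mem_insert, mem_filter, mem_univ, true_and] at hx ⊢
      rcases hx with rfl | hx
      · exact .inr hy
      · exact .inl ((hcon x (hadj x hx)).eq_of_adj hy hx.symm))
  have hsub : Aᶜ ⊆ {b} := by
    intro x hx
    have h1 := mem_univ x
    rw [← hcl] at h1
    simp only [mem_insert, mem_filter, mem_univ, true_and] at h1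
    rcases h1 with rfl | h1
    · exact mem_singleton_self x
    · exact absurd (hadj x h1) (mem_compl.1 hx)
  have := card_le_card hsub
  rw [card_singleton] at this
  omega

/-- An avoided leaf always lies in the class with `k + 1` vertices, and one vertex of that class is
not a leaf. -/
lemma IsTree.card_avoidableSets_one_le (hG : G.IsTree) {k : ℕ} (hk : 3 ≤ k)
    (hV : Fintype.card V = 2 * k + 1) : #(G.avoidableSets 1) ≤ k ∧
      (#(G.avoidableSets 1) = k → Nonempty (G ≃g spider k)) := by
  rcases (G.avoidableSets 1).eq_empty_or_nonempty with h | ⟨S, hS⟩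
  · rw [h, card_empty]
    omega
  obtain ⟨A, hA, hcard⟩ : ∃ A : Finset V, G.IsColourClass A ∧ #A = #Aᶜ + 1 := by
    obtain ⟨A, hA⟩ := hG.exists_isColourClass
    obtain ⟨h1, -, m, hm⟩ := mem_avoidableSets.1 hS
    have h2 := hm.card_add_card_inter hA
    have h3 := card_inter_add_card_compl_inter A S
    by_cases h4 : #A = #Aᶜ + 1
    · exact ⟨A, hA, h4⟩
    · exact ⟨Aᶜ, hA.compl, by rw [compl_compl]; omega⟩
  set L := A.filter fun u => {u} ∈ G.avoidableSets 1 with hL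
  have hsub : G.avoidableSets 1 ⊆ L.image singleton := by
    intro T hT
    obtain ⟨h1, -, m, hm⟩ := mem_avoidableSets.1 hT
    obtain ⟨u, rfl⟩ := card_eq_one.1 h1
    have h2 := hm.card_add_card_inter hA
    have h3 := card_inter_add_card_compl_inter A {u}
    obtain ⟨x, hx⟩ := card_pos.1 (by omega : 0 < #(A ∩ {u}))
    rw [mem_inter, mem_singleton] at hx
    obtain ⟨hxA, rfl⟩ := hx
    exact mem_image.2 ⟨x, mem_filter.2 ⟨hxA, hT⟩, rfl⟩
  have hle := (card_le_card hsub).trans card_image_le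
  have hsum := card_compl_add_card A
  obtain ⟨c, hcA, hc⟩ := hA.exists_not_isLeafVertex hG (by omega)
  have hLc : L ⊆ A.erase c := by
    intro u hu
    obtain ⟨huA, hu⟩ := mem_filter.1 hu
    refine mem_erase.2 ⟨?_, huA⟩
    rintro rfl
    exact hc (mem_avoidableSets_singleton hu).1
  have hLcard := card_le_card hLc
  rw [card_erase_of_mem hcA] at hLcard
  refine ⟨by omega, fun h => ?_⟩
  have hLeq := eq_of_subset_of_card_le hLc (by rw [card_erase_of_mem hcA]; omega)
  refine hG.nonempty_iso_spider hk hV hA (c := c) (L := L) ?_ ?_ (by omega)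
    fun u hu => (mem_filter.1 hu).2
  · rw [hLeq]; exact notMem_erase c A
  · rw [hLeq, insert_erase hcA]

/-! ### Trees of order two -/

lemma IsTree.adj_of_card_eq_two (hG : G.IsTree) (hV : Fintype.card V = 2) {v w : V}
    (hvw : v ≠ w) : G.Adj v w := by
  have : Nontrivial V := ⟨v, w, hvw⟩
  obtain ⟨x, hx⟩ := hG.nbrs_nonempty (singleton_nonempty v)
  obtain ⟨y, hy, hyx⟩ := mem_nbrs.1 hx
  rw [mem_singleton] at hy
  subst hy
  have huniv : ({y, w} : Finset V) = univ := eq_univ_of_card _ (by rw [card_pair hvw, hV])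
  have := mem_univ x
  rw [← huniv, mem_insert, mem_singleton] at this
  rcases this with rfl | rfl
  · exact absurd rfl hyx.ne
  · exact hyx

lemma IsTree.card_avoidableSets_of_card_eq_two (hG : G.IsTree) (hV : Fintype.card V = 2) :
    #(G.avoidableSets 2) = 1 := by
  have : Nontrivial V := Fintype.one_lt_card_iff_nontrivial.1 (by omega)
  refine card_eq_one.2 ⟨univ, ?_⟩
  ext S
  rw [mem_singleton, mem_avoidableSets]
  constructor
  · intro h
    exact eq_univ_of_card _ (by rw [h.1, hV])
  · rintro rfl
    refine ⟨by rw [card_univ, hV], fun v _ => ?_, id, fun v hv => absurd (mem_univ v) hv⟩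
    obtain ⟨w, hw⟩ := exists_ne v
    refine isLeafVertex_of_forall (w := w) fun x => ⟨fun hx => ?_, ?_⟩
    · have huniv : ({v, w} : Finset V) = univ :=
        eq_univ_of_card _ (by rw [card_pair hw.symm, hV])
      have := mem_univ x
      rw [← huniv, mem_insert, mem_singleton] at this
      exact this.resolve_left hx.ne'
    · rintro rfl
      exact hG.adj_of_card_eq_two hV hw.symm

lemma IsTree.nonempty_iso_pathGraph_two (hG : G.IsTree) (hV : Fintype.card V = 2) :
    Nonempty (G ≃g pathGraph 2) := by
  let e := (finCongr hV.symm).trans (Fintype.equivFin V).symm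
  exact hG.nonempty_iso_of_surjective (pathGraph_connected 1) e
    (fun x y h => hG.adj_of_card_eq_two hV (e.injective.ne h.ne)) e.surjective (by simp [hV])

/-! ### The maximum -/

lemma IsTree.numSAPM_of_even (hG : G.IsTree) {n : ℕ} (hV : Fintype.card V = n) (hn : Even n) :
    G.numSAPM = #(G.avoidableSets 2) := by
  rw [hG.numSAPM_eq, Nat.card_eq_fintype_card, hV, if_pos hn]

lemma IsTree.numSAPM_of_odd (hG : G.IsTree) {n : ℕ} (hV : Fintype.card V = n) (hn : Odd n) :
    G.numSAPM = #(G.avoidableSets 1) := by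
  rw [hG.numSAPM_eq, Nat.card_eq_fintype_card, hV, if_neg (Nat.not_even_iff_odd.2 hn)]

lemma isMaxNumSAPM_of_isTree {n k : ℕ} (hn : Even n) {W : Type*} [Fintype W]
    {H : SimpleGraph W} (hH : H.IsTree) (hW : Fintype.card W = n) (hk : k ≤ #(H.avoidableSets 2))
    (hle : ∀ T : SimpleGraph (Fin n), T.IsTree → #(T.avoidableSets 2) ≤ k) :
    IsMaxNumSAPM n k := by
  let e := H.overFinIso hW
  have htree : (H.overFin hW).IsTree := e.isTree_iff.1 hH
  refine ⟨⟨H.overFin hW, htree, ?_⟩, ?_⟩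
  · rw [htree.numSAPM_of_even (Fintype.card_fin n) hn]
    refine le_antisymm (hle _ htree) ?_
    rwa [← e.card_avoidableSets_eq]
  · rintro m ⟨T, hT, rfl⟩
    rw [hT.numSAPM_of_even (Fintype.card_fin n) hn]
    exact hle T hT

lemma isMaxNumSAPM_two : IsMaxNumSAPM 2 1 := by
  -- Without leaves the double broom is just its central edge, the tree of order two.
  have htree : (doubleBroom 0 0).IsTree := doubleBroom_isTree 0 0
  have hV' : Fintype.card (Option (Fin 0) ⊕ Option (Fin 0)) = 2 := by simp
  exact isMaxNumSAPM_of_isTree even_two htree hV'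
    (htree.card_avoidableSets_of_card_eq_two hV').ge
    fun T hT => (hT.card_avoidableSets_of_card_eq_two (Fintype.card_fin 2)).le

/-- The converse of `trioCount_le_evenMax`: every listed parameter choice attains the maximum. For
`s > 12` there are three residue patterns, according to how many parameters equal `c + 1`. -/
lemma IsExtremalTrio.evenMax_le {s a b c : ℕ} (hab : b ≤ a) (hbc : c ≤ b)
    (h : IsExtremalTrio s a b c) : evenMax s ≤ trioCount a b c := by
  obtain ⟨hsum, h1, ⟨h2, rfl, rfl⟩ | ⟨h2, h3, h4, rfl⟩ | ⟨h2, h3⟩⟩ := h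
  · obtain rfl : a = s := by omega
    interval_cases a <;> first | exact absurd rfl h1 | decide
  · obtain rfl : a = (s + 1) / 2 := by omega
    obtain rfl : b = s / 2 := by omega
    interval_cases s <;> decide
  · have h4 : trioCount a b c = a * b + a * c + b * c := by
      simp [trioCount, show max c 1 = c by omega, show max b 1 = b by omega,
        show max a 1 = a by omega]
    rcases eq_or_lt_of_le h2 with rfl | h2
    · obtain rfl : a = 4 := by omega
      obtain rfl : b = 4 := by omega
      obtain rfl : c = 4 := by omega
      decide
    · have h5 : evenMax s = s ^ 2 / 3 := by
        unfold evenMax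
        simp [show s ≠ 0 by omega, show s ≠ 1 by omega, show ¬ s ≤ 5 by omega,
          show ¬ s ≤ 12 by omega]
      rw [h4, h5, ← Nat.lt_succ_iff, Nat.div_lt_iff_lt_mul (by norm_num)]
      have h6 : (a = c ∧ b = c) ∨ (a = c + 1 ∧ b = c) ∨ (a = c + 1 ∧ b = c + 1) := by omega
      subst hsum
      rcases h6 with ⟨rfl, rfl⟩ | ⟨rfl, rfl⟩ | ⟨rfl, rfl⟩ <;> nlinarith

lemma exists_isExtremalTrio {s : ℕ} (hs : s ≠ 1) :
    ∃ a b c, b ≤ a ∧ c ≤ b ∧ IsExtremalTrio s a b c := by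
  unfold IsExtremalTrio
  by_cases h1 : s ≤ 5
  · exact ⟨s, 0, 0, by omega, by omega, by omega⟩
  · by_cases h2 : s ≤ 12
    · exact ⟨(s + 1) / 2, s / 2, 0, by omega, by omega, by omega⟩
    · exact ⟨(s + 2) / 3, (s + 1) / 3, s / 3, by omega, by omega, by omega⟩

lemma isMaxNumSAPM_evenMax {n s : ℕ} (hn : n = 2 * s + 4) : IsMaxNumSAPM n (evenMax s) := by
  have heven : Even n := ⟨s + 2, by omega⟩
  have hle : ∀ T : SimpleGraph (Fin n), T.IsTree → #(T.avoidableSets 2) ≤ evenMax s :=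
    fun T hT => (hT.card_avoidableSets_two_le (by rw [Fintype.card_fin, hn])).1
  by_cases hs : s = 1
  · subst hs
    exact isMaxNumSAPM_of_isTree heven (doubleBroom_isTree 2 2) (by simp [hn])
      four_le_card_avoidableSets_doubleBroom hle
  · obtain ⟨a, b, c, hab, hbc, h⟩ := exists_isExtremalTrio hs
    refine isMaxNumSAPM_of_isTree heven (spiderTrio_isTree a b c) ?_
      ((h.evenMax_le hab hbc).trans (trioCount_le_card_avoidableSets a b c)) hle
    rw [card_spiderTrio, h.1, hn]

/-- The extremal trees of order `2 * s + 4`. -/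
lemma IsTree.numSAPM_eq_evenMax_iff (hG : G.IsTree) {s : ℕ} (hV : Fintype.card V = 2 * s + 4) :
    G.numSAPM = evenMax s ↔ (s = 1 ∧ Nonempty (G ≃g doubleBroom 2 2)) ∨
      ∃ a b c, b ≤ a ∧ c ≤ b ∧ IsExtremalTrio s a b c ∧ Nonempty (G ≃g spiderTrio a b c) := by
  rw [hG.numSAPM_of_even hV ⟨s + 2, by omega⟩]
  obtain ⟨h1, h2⟩ := hG.card_avoidableSets_two_le hV
  refine ⟨h2, fun h => le_antisymm h1 ?_⟩
  rcases h with ⟨rfl, ⟨e⟩⟩ | ⟨a, b, c, hab, hbc, h, ⟨e⟩⟩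
  · rw [e.card_avoidableSets_eq]
    exact four_le_card_avoidableSets_doubleBroom
  · rw [e.card_avoidableSets_eq]
    exact (h.evenMax_le hab hbc).trans (trioCount_le_card_avoidableSets a b c)

lemma IsMaxNumSAPM.unique {n k l : ℕ} (hk : IsMaxNumSAPM n k) (hl : IsMaxNumSAPM n l) : k = l :=
  IsGreatest.unique hk hl

lemma IsTree.isMaxNumSAPM_iff (hG : G.IsTree) {n s : ℕ} (hn : n = 2 * s + 4)
    (hV : Fintype.card V = n) :
    IsMaxNumSAPM n G.numSAPM ↔ (s = 1 ∧ Nonempty (G ≃g doubleBroom 2 2)) ∨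
      ∃ a b c, b ≤ a ∧ c ≤ b ∧ IsExtremalTrio s a b c ∧ Nonempty (G ≃g spiderTrio a b c) := by
  rw [← hG.numSAPM_eq_evenMax_iff (hV.trans hn)]
  exact ⟨fun h => h.unique (isMaxNumSAPM_evenMax hn), fun h => h ▸ isMaxNumSAPM_evenMax hn⟩

lemma evenMax_eq_div_twelve {n s : ℕ} (hn : n = 2 * s + 4) (hs : 12 ≤ s) :
    evenMax s = (n - 4) ^ 2 / 12 := by
  have h1 : (n - 4) ^ 2 / 12 = s ^ 2 / 3 := by
    rw [show n - 4 = 2 * s by omega, mul_pow, show 12 = 2 ^ 2 * 3 by norm_num,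
      Nat.mul_div_mul_left _ _ (by norm_num)]
  rw [h1]
  -- At `s = 12` the definition of `evenMax` still uses its quadratic branch with denominator 4,
  -- which agrees with `s ^ 2 / 3` there.
  rcases eq_or_lt_of_le hs with rfl | hs
  · decide
  · unfold evenMax
    simp [show s ≠ 0 by omega, show s ≠ 1 by omega, show ¬ s ≤ 5 by omega,
      show ¬ s ≤ 12 by omega]

end
end SimpleGraph

namespace SimpleGraph
section

variable {V : Type*} {G : SimpleGraph V}

/-! ### Explicit parameters and the main theorem -/

/-- Sorted parameters with a given sum that are as equal as possible are unique. The ranges overlap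
at `s = 5` and `s = 12`, which produces the two extremal trees of orders 14 and 28. -/
lemma exists_isExtremalTrio_iff {s : ℕ} {p : ℕ → ℕ → ℕ → Prop} :
    (∃ a b c, b ≤ a ∧ c ≤ b ∧ IsExtremalTrio s a b c ∧ p a b c) ↔
      s ≠ 1 ∧ ((s ≤ 5 ∧ p s 0 0) ∨ (5 ≤ s ∧ s ≤ 12 ∧ p ((s + 1) / 2) (s / 2) 0) ∨
        (12 ≤ s ∧ p ((s + 2) / 3) ((s + 1) / 3) (s / 3))) := by
  constructor
  · rintro ⟨a, b, c, hab, hbc, ⟨hsum, h1, ⟨h2, rfl, rfl⟩ | ⟨h2, h3, h4, rfl⟩ | ⟨h2, h3⟩⟩, hp⟩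
    · obtain rfl : a = s := by omega
      exact ⟨h1, .inl ⟨h2, hp⟩⟩
    · obtain rfl : a = (s + 1) / 2 := by omega
      obtain rfl : b = s / 2 := by omega
      exact ⟨h1, .inr (.inl ⟨h2, h3, hp⟩)⟩
    · obtain rfl : a = (s + 2) / 3 := by omega
      obtain rfl : b = (s + 1) / 3 := by omega
      obtain rfl : c = s / 3 := by omega
      exact ⟨h1, .inr (.inr ⟨h2, hp⟩)⟩
  · rintro ⟨h1, ⟨h2, hp⟩ | ⟨h2, h3, hp⟩ | ⟨h2, hp⟩⟩
    · exact ⟨s, 0, 0, by omega, by omega, by unfold IsExtremalTrio; omega, hp⟩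
    · exact ⟨_, _, 0, by omega, by omega, by unfold IsExtremalTrio; omega, hp⟩
    · exact ⟨_, _, _, by omega, by omega, by unfold IsExtremalTrio; omega, hp⟩

lemma nonempty_iso_congr {W W' : Type*} {H : SimpleGraph W} {H' : SimpleGraph W'}
    (h : Nonempty (H ≃g H')) : Nonempty (G ≃g H) ↔ Nonempty (G ≃g H') := by
  obtain ⟨e⟩ := h
  exact ⟨fun ⟨f⟩ => ⟨f.trans e⟩, fun ⟨f⟩ => ⟨f.trans e.symm⟩⟩

lemma isBalancedSpiderTrio_iff {s : ℕ} (hV : Nat.card V = 2 * s + 4) :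
    G.IsBalancedSpiderTrio ↔
      Nonempty (G ≃g spiderTrio ((s + 2) / 3) ((s + 1) / 3) (s / 3)) := by
  constructor
  · rintro ⟨a, b, c, hab, hbc, hac, ⟨e⟩⟩
    have h1 := Nat.card_congr e.toEquiv
    rw [hV, Nat.card_eq_fintype_card, card_spiderTrio] at h1
    obtain rfl : a = (s + 2) / 3 := by omega
    obtain rfl : b = (s + 1) / 3 := by omega
    obtain rfl : c = s / 3 := by omega
    exact ⟨e⟩
  · intro h
    exact ⟨_, _, _, by omega, by omega, by omega, h⟩

end
end SimpleGraph

open SimpleGraph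

theorem mainTheorem3 :
    -- the maximum `f(n)` for even `n`
    (∀ n : ℕ, Even n →
      (2 ≤ n → n ≤ 6 → SimpleGraph.IsMaxNumSAPM n (3 * n / 4)) ∧
      (8 ≤ n → n ≤ 14 → SimpleGraph.IsMaxNumSAPM n (n - 3)) ∧
      (16 ≤ n → n ≤ 28 → SimpleGraph.IsMaxNumSAPM n (n ^ 2 / 16 - 1)) ∧
      (28 ≤ n → SimpleGraph.IsMaxNumSAPM n ((n - 4) ^ 2 / 12))) ∧
    -- the trees of even order `n` whose number of strong almost-perfect matchings is `f(n)`
    (∀ (V : Type u) [Finite V] (T : SimpleGraph V) (n : ℕ),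
      T.IsTree → Nat.card V = n → Even n →
      (n = 2 → (SimpleGraph.IsMaxNumSAPM n T.numSAPM ↔
        Nonempty (T ≃g SimpleGraph.pathGraph 2))) ∧
      (n = 4 → (SimpleGraph.IsMaxNumSAPM n T.numSAPM ↔
        Nonempty (T ≃g SimpleGraph.starGraph (0 : Fin 4)))) ∧
      (n = 6 → (SimpleGraph.IsMaxNumSAPM n T.numSAPM ↔
        Nonempty (T ≃g SimpleGraph.doubleBroom 2 2))) ∧
      (8 ≤ n → n ≤ 12 → (SimpleGraph.IsMaxNumSAPM n T.numSAPM ↔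
        Nonempty (T ≃g SimpleGraph.evenSpecialSpider n))) ∧
      (n = 14 → (SimpleGraph.IsMaxNumSAPM n T.numSAPM ↔
        Nonempty (T ≃g SimpleGraph.evenSpecialSpider 14) ∨
        Nonempty (T ≃g SimpleGraph.spiderTrio 3 2 0))) ∧
      (16 ≤ n → n ≤ 26 → (SimpleGraph.IsMaxNumSAPM n T.numSAPM ↔
        Nonempty (T ≃g SimpleGraph.spiderTrio ((n - 4) ⌈/⌉ 4) ((n - 4) / 4) 0))) ∧
      (n = 28 → (SimpleGraph.IsMaxNumSAPM n T.numSAPM ↔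
        Nonempty (T ≃g SimpleGraph.spiderTrio 6 6 0) ∨
        Nonempty (T ≃g SimpleGraph.spiderTrio 4 4 4))) ∧
      (28 < n → (SimpleGraph.IsMaxNumSAPM n T.numSAPM ↔
        Nonempty (T ≃g SimpleGraph.spiderTrio (n / 6) ((n - 2) / 6) ((n - 4) / 6))))) ∧
    -- all orders `n ≥ 28`, odd or even
    (∀ (V : Type u) [Finite V] (T : SimpleGraph V) (n : ℕ),
      T.IsTree → Nat.card V = n → 28 ≤ n →
      (Odd n → T.numSAPM ≤ (n - 1) / 2 ∧
        (T.numSAPM = (n - 1) / 2 ↔ Nonempty (T ≃g SimpleGraph.spider ((n - 1) / 2)))) ∧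
      (Even n → T.numSAPM ≤ (n - 4) ^ 2 / 12 ∧
        (T.numSAPM = (n - 4) ^ 2 / 12 ↔
          T.IsBalancedSpiderTrio ∨
          (n = 28 ∧ Nonempty (T ≃g SimpleGraph.spiderTrio 6 6 0))))) := by
  refine ⟨fun n hn => ⟨fun h1 h2 => ?_, fun h1 h2 => ?_, fun h1 h2 => ?_, fun h1 => ?_⟩,
    fun V _ T n hT hV hn => ?_, fun V _ T n hT hV hn => ⟨fun hodd => ?_, fun heven => ?_⟩⟩
  · by_cases h3 : n = 2
    · subst h3
      exact isMaxNumSAPM_two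
    · have h4 : n = 4 ∨ n = 6 := by
        obtain ⟨k, rfl⟩ := hn
        omega
      rcases h4 with rfl | rfl
      · exact isMaxNumSAPM_evenMax (s := 0) rfl
      · exact isMaxNumSAPM_evenMax (s := 1) rfl
  · obtain ⟨k, rfl⟩ := hn
    obtain ⟨s, rfl⟩ := Nat.exists_eq_add_of_le (show 2 ≤ k by omega)
    have h := isMaxNumSAPM_evenMax (n := 2 + s + (2 + s)) (s := s) (by omega)
    have h3 : evenMax s = 2 + s + (2 + s) - 3 := by
      simp [evenMax, show s ≠ 0 by omega, show s ≠ 1 by omega, show s ≤ 5 by omega]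
      omega
    rwa [h3] at h
  · obtain ⟨k, rfl⟩ := hn
    obtain ⟨s, rfl⟩ := Nat.exists_eq_add_of_le (show 2 ≤ k by omega)
    have h := isMaxNumSAPM_evenMax (n := 2 + s + (2 + s)) (s := s) (by omega)
    have h3 : evenMax s = (2 + s + (2 + s)) ^ 2 / 16 - 1 := by
      have h4 : (2 + s + (2 + s)) ^ 2 / 16 = (s + 2) ^ 2 / 4 := by
        rw [show 2 + s + (2 + s) = 2 * (s + 2) by omega, mul_pow,
          show 16 = 2 ^ 2 * 4 by norm_num, Nat.mul_div_mul_left _ _ (by norm_num)]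
      rw [h4]
      simp [evenMax, show s ≠ 0 by omega, show s ≠ 1 by omega, show ¬ s ≤ 5 by omega,
        show s ≤ 12 by omega]
    rwa [h3] at h
  · obtain ⟨k, rfl⟩ := hn
    obtain ⟨s, rfl⟩ := Nat.exists_eq_add_of_le (show 2 ≤ k by omega)
    have h := isMaxNumSAPM_evenMax (n := 2 + s + (2 + s)) (s := s) (by omega)
    rwa [evenMax_eq_div_twelve (n := 2 + s + (2 + s)) (by omega) (by omega)] at h
  · cases nonempty_fintype V
    rw [Nat.card_eq_fintype_card] at hV
    -- The right-hand side is left to unification: it is the explicit disjunction of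
    -- `exists_isExtremalTrio_iff`, which each range of orders then simplifies.
    have key : ∀ s, n = 2 * s + 4 → (IsMaxNumSAPM n T.numSAPM ↔ _) := fun s hs => by
      rw [hT.isMaxNumSAPM_iff hs hV, exists_isExtremalTrio_iff]
    refine ⟨?_, ?_, ?_, ?_, ?_, ?_, ?_, ?_⟩
    · rintro rfl
      refine ⟨fun _ => hT.nonempty_iso_pathGraph_two hV, fun _ => ?_⟩
      rw [hT.numSAPM_of_even hV hn, hT.card_avoidableSets_of_card_eq_two hV]
      exact isMaxNumSAPM_two
    · rintro rfl
      rw [key 0 rfl, ← nonempty_iso_congr nonempty_spiderTrio_iso_starGraph]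
      simp
    · rintro rfl
      rw [key 1 rfl]
      simp
    · intro h1 h2
      obtain ⟨k, rfl⟩ := hn
      obtain ⟨s, rfl⟩ := Nat.exists_eq_add_of_le (show 2 ≤ k by omega)
      rw [key s (by omega), ← nonempty_iso_congr
        (nonempty_spiderTrio_iso_evenSpecialSpider s _ (by omega))]
      simp [show s ≠ 1 by omega, show s ≤ 5 by omega, show ¬ 5 ≤ s by omega,
        show ¬ 12 ≤ s by omega]
    · rintro rfl
      rw [key 5 rfl, ← nonempty_iso_congr
        (nonempty_spiderTrio_iso_evenSpecialSpider 5 14 (by omega))]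
      simp
    · intro h1 h2
      obtain ⟨k, rfl⟩ := hn
      obtain ⟨s, rfl⟩ := Nat.exists_eq_add_of_le (show 2 ≤ k by omega)
      have h3 : (2 + s + (2 + s) - 4) ⌈/⌉ 4 = (s + 1) / 2 := by
        rw [Nat.ceilDiv_eq_add_pred_div]
        omega
      have h4 : (2 + s + (2 + s) - 4) / 4 = s / 2 := by omega
      rw [key s (by omega), h3, h4]
      simp [show s ≠ 1 by omega, show ¬ s ≤ 5 by omega, show 5 ≤ s by omega,
        show s ≤ 12 by omega, show ¬ 12 ≤ s by omega]
    · rintro rfl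
      rw [key 12 rfl]
      simp
    · intro h1
      obtain ⟨k, rfl⟩ := hn
      obtain ⟨s, rfl⟩ := Nat.exists_eq_add_of_le (show 2 ≤ k by omega)
      have h3 : (2 + s + (2 + s)) / 6 = (s + 2) / 3 := by omega
      have h4 : (2 + s + (2 + s) - 2) / 6 = (s + 1) / 3 := by omega
      have h5 : (2 + s + (2 + s) - 4) / 6 = s / 3 := by omega
      rw [key s (by omega), h3, h4, h5]
      simp [show s ≠ 1 by omega, show ¬ s ≤ 5 by omega, show ¬ s ≤ 12 by omega,
        show 12 ≤ s by omega]
  · cases nonempty_fintype V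
    rw [Nat.card_eq_fintype_card] at hV
    obtain ⟨k, rfl⟩ := hodd
    have h1 : (2 * k + 1 - 1) / 2 = k := by omega
    rw [h1, hT.numSAPM_of_odd hV ⟨k, rfl⟩]
    obtain ⟨h2, h3⟩ := hT.card_avoidableSets_one_le (by omega) hV
    refine ⟨h2, h3, fun ⟨e⟩ => le_antisymm h2 ?_⟩
    rw [e.card_avoidableSets_eq]
    exact le_card_avoidableSets_spider (by omega)
  · have hV' := hV
    cases nonempty_fintype V
    rw [Nat.card_eq_fintype_card] at hV
    obtain ⟨k, hk⟩ := heven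
    obtain ⟨s, rfl⟩ := Nat.exists_eq_add_of_le (show 2 ≤ k by omega)
    have hs : n = 2 * s + 4 := by omega
    rw [← evenMax_eq_div_twelve hs (by omega),
      hT.numSAPM_eq_evenMax_iff (hV.trans hs), exists_isExtremalTrio_iff,
      isBalancedSpiderTrio_iff (hV'.trans hs)]
    refine ⟨?_, ?_⟩
    · rw [hT.numSAPM_of_even (hV.trans hs) ⟨s + 2, by omega⟩]
      exact (hT.card_avoidableSets_two_le (hV.trans hs)).1
    · rcases eq_or_lt_of_le (show 12 ≤ s by omega) with rfl | h12
      · simp [hs, or_comm]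
      · simp [show s ≠ 1 by omega, show ¬ s ≤ 5 by omega, show ¬ s ≤ 12 by omega,
          show 12 ≤ s by omega, show n ≠ 28 by omega]
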